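/- Let $d\ge 2$ be a squarefree integer, let $K=\mathbb{Q}(\sqrt d)$ with ring of integers $\mathcal{O}_K$, and call a prime number $p$ inert if $p\mathcal{O}_K$ is a prime ideal and ramified if $p\mathcal{O}_K$ is the square of a prime ideal. Let $f$ be the product of a nonempty finite set of ramified primes and a (possibly empty) finite set of inert primes. Let $\mathcal{O}$ be the order in $K$ with conductor $f\mathcal{O}_K$ (that is, $\{x\in\mathcal{O}_K : x\mathcal{O}_K\subseteq\mathcal{O}\}=f\mathcal{O}_K$), and assume that the Picard groups satisfy $|\mathrm{Pic}(\mathcal{O})|=|\mathrm{Pic}(\mathcal{O}_K)|=2$. Suppose that every ramified prime $p$ dividing $f$ satisfies at least one of the following, where $\left(\frac{\cdot}{\cdot}\right)$ denotes the Legendre symbol: (i) $p\equiv 1 \pmod 4$ and $\left(\frac{d/p}{p}\right)=-1$; (ii) there is a prime $q\equiv 1\pmod 4$ with $q\mid df$ and $\left(\frac{p}{q}\right)=-1$. Then $\min\Delta(\mathcal{O})=2$; that is, $\Delta(\mathcal{O})$ is nonempty and its least element is $2$. Here $\Delta(\mathcal{O})$ is the set of distances of the multiplicative monoid $\mathcal{O}\setminus\{0\}$: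 for nonzero $a\in\mathcal{O}$ let $\mathsf{L}(a)\subseteq\mathbb{N}_0$ be the set of all $k$ such that $a$ is, up to a unit, a product of $k$ irreducible elements of $\mathcal{O}$; then $\Delta(\mathcal{O})$ is the set of all integers $\delta\ge 1$ such that for some nonzero $a\in\mathcal{O}$ and some $k\in\mathsf{L}(a)$ one has $\mathsf{L}(a)\cap[k,k+\delta]=\{k,k+\delta\}$. -/

import Mathlib

open scoped NumberField nonZeroDivisors

namespace QuadOrder

/-! ### Sets of lengths and sets of distances -/

section Monoids

/-- The set of factorizations of `a`: the elements of the free abelian monoid on the atoms of the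
reduced monoid `H_red = Associates H` whose product is the class of `a`. -/
def factorizations (H : Type*) [CommMonoid H] (a : H) : Set (Multiset (Associates H)) :=
  {z | (∀ u ∈ z, Irreducible u) ∧ z.prod = Associates.mk a}

/-- The set of lengths `L(a)`: all cardinalities (with multiplicity) of factorizations of `a`. -/
def lengths (H : Type*) [CommMonoid H] (a : H) : Set ℕ :=
  Multiset.card '' factorizations H a

/-- The set of distances `Δ(L)` of a set `L` of natural numbers: the positive `δ` such that
`L ∩ [k, k + δ] = {k, k + δ}` for some `k ∈ L`. -/
def distances (L : Set ℕ) : Set ℕ :=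
  {δ | 0 < δ ∧ ∃ k ∈ L, L ∩ Set.Icc k (k + δ) = {k, k + δ}}

/-- The set of distances `Δ(H)` of a monoid: the union of the `Δ(L(a))` over all `a` in `H`. -/
def monoidDistances (H : Type*) [CommMonoid H] : Set ℕ :=
  ⋃ a : H, distances (lengths H a)

/-- The set of distances `Δ(R)` of a domain: that of its multiplicative monoid `R ∖ {0}`. -/
def ringDistances (R : Type*) [CommRing R] [IsDomain R] : Set ℕ :=
  monoidDistances R⁰

end Monoids

/-! ### Orders and ramification -/

section Orders

variable {K : Type*} [Field K]

/-- A subring `O` of the ring of integers of `K` is an order if `K` is its field of fractions and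
the ring of integers is a finitely generated `O`-module. -/
def IsOrder (O : Subring (𝓞 K)) : Prop :=
  IsFractionRing O K ∧ Module.Finite O (𝓞 K)

/-- The conductor `(O : 𝓞 K)` of `O`, as an ideal of the ring of integers. -/
def orderConductor (O : Subring (𝓞 K)) : Ideal (𝓞 K) where
  carrier := {x | ∀ y : 𝓞 K, x * y ∈ O}
  zero_mem' y := by simp
  add_mem' ha hb y := by
    rw [add_mul]
    exact O.add_mem (ha y) (hb y)
  smul_mem' c x hx y := by
    rw [smul_eq_mul, mul_comm c x, mul_assoc]
    exact hx (c * y)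

variable (K)

/-- `p` is an inert prime of `K`: `p 𝓞_K` is a prime ideal. -/
def IsInert (p : ℕ) : Prop :=
  p.Prime ∧ (Ideal.span {(p : 𝓞 K)}).IsPrime

/-- `p` is a ramified prime of the quadratic field `K`: `p 𝓞_K` is the square of a prime ideal. -/
def IsRamified (p : ℕ) : Prop :=
  p.Prime ∧ ∃ P : Ideal (𝓞 K), P.IsPrime ∧ Ideal.span {(p : 𝓞 K)} = P ^ 2

/-- `f` is a nonempty squarefree product of ramified primes times a (possibly empty) squarefree
product of inert primes. -/
def IsRamifiedTimesInert (f : ℕ) : Prop :=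
  ∃ S T : Finset ℕ, S.Nonempty ∧ (∀ p ∈ S, IsRamified K p) ∧ (∀ p ∈ T, IsInert K p) ∧
    f = (∏ p ∈ S, p) * ∏ p ∈ T, p

end Orders

end QuadOrder

/-!
Since `Pic O` is as small as `Pic (𝓞 K)`, every element of `𝓞 K` coprime to `f` is a unit multiple
of an element of `O`. Hence sending `x` to the multiset of prime ideal factors of `x 𝓞_K` is a
transfer homomorphism from `O ∖ {0}` onto the multisets of primes which have an even number of
nonprincipal members and contain no ramified prime over `f` exactly once. Moreover, those ramified
primes are nonprincipal: a generator of one over `p` would have norm `±p`, which (i) excludes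
modulo `p` and (ii) modulo `q`.

In the target, give a ramified prime over `f` weight `3`, any other nonprincipal prime weight `1`
and a principal prime weight `2`. Every atom then has weight `2` modulo `4`, so all lengths of an
element have the same parity. With `P` ramified over `f` and `Q` another nonprincipal prime, the
relation `(P³ Q)² = (P²)³ Q²` yields an element with the two lengths `2` and `4`.
-/

namespace QuadOrder

section ConductorOrder

variable {R : Type*} [CommRing R]

theorem isCoprime_natCast_natCast {a b : ℕ} (h : a.Coprime b) : IsCoprime (a : R) (b : R) := by
  simpa using (Nat.isCoprime_iff_coprime.2 h).map (Int.castRingHom R)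

theorem exists_forall_prime_dvd_sub {f : ℕ} (hf : f ≠ 0) (x : ℕ → R) :
    ∃ z : R, ∀ p : ℕ, p.Prime → p ∣ f → (p : R) ∣ z - x p := by
  let I : f.primeFactors → Ideal R := fun p => Ideal.span {((p : ℕ) : R)}
  have hI : Pairwise fun i j => IsCoprime (I i) (I j) := fun i j hij =>
    (Ideal.isCoprime_span_singleton_iff _ _).2 <| isCoprime_natCast_natCast <|
      (Nat.coprime_primes (Nat.prime_of_mem_primeFactors i.2)
        (Nat.prime_of_mem_primeFactors j.2)).2 (Subtype.coe_injective.ne hij)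
  obtain ⟨z, hz⟩ := Ideal.pi_quotient_surjective hI fun i => x i
  refine ⟨z, fun p hp hpf => ?_⟩
  have hzp := hz ⟨p, Nat.mem_primeFactors.2 ⟨hp, hpf, hf⟩⟩
  rwa [Ideal.Quotient.eq, Ideal.mem_span_singleton] at hzp

theorem isCoprime_natCast_of_forall_prime {f : ℕ} (hf : Squarefree f) {x : R}
    (h : ∀ p : ℕ, p.Prime → p ∣ f → IsCoprime x (p : R)) : IsCoprime x (f : R) := by
  rw [← Nat.prod_primeFactors_of_squarefree hf, Nat.cast_prod]
  exact IsCoprime.prod_right fun p hp =>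
    h p (Nat.prime_of_mem_primeFactors hp) (Nat.dvd_of_mem_primeFactors hp)

theorem natCast_dvd_of_forall_prime {f : ℕ} (hf : Squarefree f) {x : R}
    (h : ∀ p : ℕ, p.Prime → p ∣ f → (p : R) ∣ x) : (f : R) ∣ x := by
  rw [← Nat.prod_primeFactors_of_squarefree hf, Nat.cast_prod]
  refine Finset.prod_dvd_of_coprime (fun p hp q hq hpq => ?_) fun p hp =>
    h p (Nat.prime_of_mem_primeFactors hp) (Nat.dvd_of_mem_primeFactors hp)
  exact isCoprime_natCast_natCast ((Nat.coprime_primes (Nat.prime_of_mem_primeFactors hp)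
    (Nat.prime_of_mem_primeFactors hq)).2 hpq)

theorem intCast_dvd_intCast {a b : ℤ} (h : a ∣ b) : (a : R) ∣ (b : R) := by
  simpa using map_dvd (Int.castRingHom R) h

theorem natCast_dvd_intCast {m : ℕ} {a : ℤ} (h : (m : ℤ) ∣ a) : (m : R) ∣ (a : R) := by
  simpa using intCast_dvd_intCast (R := R) h

variable (R) in
/-- The subring `ℤ + f R` of `R`, for `R = 𝓞 K` the order of conductor `f` in a quadratic field
`K`. It is encoded as the set of all elements whose class modulo `f` is the class of an integer. -/
def conductorOrder (f : ℕ) : Subring R :=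
  (Int.castRingHom (R ⧸ Ideal.span {(f : R)})).range.comap (Ideal.Quotient.mk _)

variable {f : ℕ} {x y : R}

theorem mem_conductorOrder_iff : x ∈ conductorOrder R f ↔ ∃ a : ℤ, (f : R) ∣ x - a := by
  simp only [conductorOrder, Subring.mem_comap, RingHom.mem_range, eq_intCast,
    ← Ideal.mem_span_singleton, ← Ideal.Quotient.eq, map_intCast, eq_comm]

theorem mem_conductorOrder_of_dvd (h : (f : R) ∣ x) : x ∈ conductorOrder R f :=
  mem_conductorOrder_iff.2 ⟨0, by simpa using h⟩

theorem conductorOrder_le_of_dvd {p : ℕ} (h : p ∣ f) : conductorOrder R f ≤ conductorOrder R p := by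
  intro x hx
  obtain ⟨a, ha⟩ := mem_conductorOrder_iff.1 hx
  exact mem_conductorOrder_iff.2 ⟨a, (Nat.cast_dvd_cast h).trans ha⟩

theorem mem_conductorOrder_of_forall_prime (hf : Squarefree f)
    (h : ∀ p : ℕ, p.Prime → p ∣ f → x ∈ conductorOrder R p) : x ∈ conductorOrder R f := by
  have hlocal : ∀ p : ℕ, ∃ a : ℤ, p.Prime → p ∣ f → (p : R) ∣ x - a := by
    intro p
    by_cases hp : p.Prime ∧ p ∣ f
    · obtain ⟨a, ha⟩ := mem_conductorOrder_iff.1 (h p hp.1 hp.2)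
      exact ⟨a, fun _ _ => ha⟩
    · exact ⟨0, fun h₁ h₂ => (hp ⟨h₁, h₂⟩).elim⟩
  choose a ha using hlocal
  obtain ⟨b, hb⟩ := exists_forall_prime_dvd_sub hf.ne_zero a
  refine mem_conductorOrder_iff.2 ⟨b, natCast_dvd_of_forall_prime hf fun p hp hpf => ?_⟩
  have hba : (p : R) ∣ (b - a p : ℤ) := natCast_dvd_intCast (by exact_mod_cast hb p hp hpf)
  simpa using dvd_sub (ha p hp hpf) hba

theorem exists_int_mul_sub_one_dvd {p : ℕ} (hp : p.Prime) {a : ℤ} (ha : ¬ (p : ℤ) ∣ a) :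
    ∃ b : ℤ, (p : ℤ) ∣ a * b - 1 := by
  obtain ⟨c, b, hbc⟩ := (Nat.prime_iff_prime_int.1 hp).coprime_iff_not_dvd.2 ha
  exact ⟨b, -c, by linear_combination hbc⟩

theorem mem_conductorOrder_of_mul_mem {p : ℕ} (hp : p.Prime) (hx : x ∈ conductorOrder R p)
    (hxp : IsCoprime x (p : R)) (hxy : x * y ∈ conductorOrder R p) : y ∈ conductorOrder R p := by
  obtain ⟨a, ha⟩ := mem_conductorOrder_iff.1 hx
  obtain ⟨c, hc⟩ := mem_conductorOrder_iff.1 hxy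
  by_cases hpa : (p : ℤ) ∣ a
  · have hpx : (p : R) ∣ x := (dvd_iff_dvd_of_dvd_sub ha).2 (natCast_dvd_intCast hpa)
    exact mem_conductorOrder_of_dvd (hxp.isUnit_of_dvd' hpx dvd_rfl).dvd
  · obtain ⟨b, hb⟩ := exists_int_mul_sub_one_dvd hp hpa
    refine mem_conductorOrder_iff.2 ⟨b * c, ?_⟩
    have hb' : (p : R) ∣ (a * b - 1 : ℤ) := natCast_dvd_intCast hb
    have key : y - (b * c : ℤ) =
        b * (x * y - c) - (b * y) * (x - a) - y * (a * b - 1 : ℤ) := by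
      push_cast
      ring
    rw [key]
    exact ((hc.mul_left _).sub (ha.mul_left _)).sub (hb'.mul_left _)

/-- At every prime divisor `p` of `f`, the element `x` is either coprime to `p` or divisible by
`p`. For squarefree `f` these are the elements of `R` which locally at `f` are associated to an
element of `conductorOrder R f`. -/
def AdmissibleAt (f : ℕ) (x : R) : Prop :=
  ∀ p : ℕ, p.Prime → p ∣ f → IsCoprime x (p : R) ∨ (p : R) ∣ x

theorem admissibleAt_self : AdmissibleAt f (f : R) :=
  fun _ _ hpf => Or.inr (Nat.cast_dvd_cast hpf)

theorem admissibleAt_of_mem_conductorOrder (hx : x ∈ conductorOrder R f) : AdmissibleAt f x := by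
  intro p hp hpf
  obtain ⟨a, ha⟩ := mem_conductorOrder_iff.1 (conductorOrder_le_of_dvd hpf hx)
  by_cases hpa : (p : ℤ) ∣ a
  · exact Or.inr ((dvd_iff_dvd_of_dvd_sub ha).2 (natCast_dvd_intCast hpa))
  · have hap : IsCoprime (a : R) (p : R) := by
      simpa using ((Nat.prime_iff_prime_int.1 hp).coprime_iff_not_dvd.2 hpa).symm.map
        (Int.castRingHom R)
    obtain ⟨c, hc⟩ := ha
    rw [sub_eq_iff_eq_add'] at hc
    exact Or.inl (hc ▸ IsCoprime.add_mul_left_left_iff.2 hap)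

theorem exists_forall_unit_mul_mem_conductorOrder {p : ℕ} (hp : p.Prime)
    (hx : IsCoprime x (p : R) ∨ (p : R) ∣ x) (hy : IsCoprime y (p : R) ∨ (p : R) ∣ y)
    (hxy : x * y ∈ conductorOrder R p) :
    ∃ z : R, IsCoprime z (p : R) ∧ ∀ u : Rˣ, u * z ∈ conductorOrder R p →
      u * x ∈ conductorOrder R p ∧ ↑u⁻¹ * y ∈ conductorOrder R p := by
  have hunit {v w : R} (u : Rˣ) (huv : u * v ∈ conductorOrder R p) (hv : IsCoprime v (p : R))
      (hvw : v * w ∈ conductorOrder R p) : ↑u⁻¹ * w ∈ conductorOrder R p := by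
    refine mem_conductorOrder_of_mul_mem hp huv
      ((isCoprime_mul_unit_left_left u.isUnit _ _).2 hv) ?_
    rwa [mul_mul_mul_comm, Units.mul_inv, one_mul]
  rcases hx with hx | hx
  · exact ⟨x, hx, fun u hu => ⟨hu, hunit u hu hx hxy⟩⟩
  rcases hy with ⟨z, b, hzb⟩ | hy
  · have hz : IsCoprime z (p : R) := ⟨y, b, by rw [mul_comm y, hzb]⟩
    refine ⟨z, hz, fun u hu => ⟨mem_conductorOrder_of_dvd (hx.mul_left _), hunit u hu hz ?_⟩⟩
    exact mem_conductorOrder_iff.2 ⟨1, -b, by push_cast; linear_combination hzb⟩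
  · exact ⟨1, isCoprime_one_left, fun u _ =>
      ⟨mem_conductorOrder_of_dvd (hx.mul_left _), mem_conductorOrder_of_dvd (hy.mul_left _)⟩⟩

theorem exists_isCoprime_forall_prime_dvd_sub (hf : Squarefree f) (z : ℕ → R)
    (hz : ∀ p : ℕ, p.Prime → p ∣ f → IsCoprime (z p) (p : R)) :
    ∃ w : R, IsCoprime w (f : R) ∧ ∀ p : ℕ, p.Prime → p ∣ f → (p : R) ∣ w - z p := by
  obtain ⟨w, hw⟩ := exists_forall_prime_dvd_sub hf.ne_zero z
  refine ⟨w, isCoprime_natCast_of_forall_prime hf fun p hp hpf => ?_, hw⟩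
  obtain ⟨c, hc⟩ := hw p hp hpf
  rw [sub_eq_iff_eq_add'] at hc
  exact hc ▸ IsCoprime.add_mul_left_left_iff.2 (hz p hp hpf)

section UnitMultiples

variable (hf : Squarefree f)
  (hunits : ∀ x : R, IsCoprime x (f : R) → ∃ u : Rˣ, u * x ∈ conductorOrder R f)

include hf hunits

theorem exists_unit_mul_mem_and_inv_mul_mem (hx : AdmissibleAt f x) (hy : AdmissibleAt f y)
    (hxy : x * y ∈ conductorOrder R f) :
    ∃ u : Rˣ, u * x ∈ conductorOrder R f ∧ ↑u⁻¹ * y ∈ conductorOrder R f := by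
  have hlocal : ∀ p : ℕ, ∃ z : R, p.Prime → p ∣ f → IsCoprime z (p : R) ∧
      ∀ u : Rˣ, u * z ∈ conductorOrder R p →
        u * x ∈ conductorOrder R p ∧ ↑u⁻¹ * y ∈ conductorOrder R p := by
    intro p
    by_cases h : p.Prime ∧ p ∣ f
    · obtain ⟨z, hz⟩ := exists_forall_unit_mul_mem_conductorOrder h.1 (hx p h.1 h.2)
        (hy p h.1 h.2) (conductorOrder_le_of_dvd h.2 hxy)
      exact ⟨z, fun _ _ => hz⟩
    · exact ⟨0, fun hp hpf => (h ⟨hp, hpf⟩).elim⟩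
  choose z hz using hlocal
  obtain ⟨w, hwf, hwz⟩ :=
    exists_isCoprime_forall_prime_dvd_sub hf z fun p hp hpf => (hz p hp hpf).1
  obtain ⟨u, hu⟩ := hunits w hwf
  have hu' (p : ℕ) (hp : p.Prime) (hpf : p ∣ f) :
      u * x ∈ conductorOrder R p ∧ ↑u⁻¹ * y ∈ conductorOrder R p := by
    refine (hz p hp hpf).2 u ?_
    rw [show u * z p = u * w - u * (w - z p) by ring]
    exact sub_mem (conductorOrder_le_of_dvd hpf hu)
      (mem_conductorOrder_of_dvd ((hwz p hp hpf).mul_left _))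
  exact ⟨u, mem_conductorOrder_of_forall_prime hf fun p hp hpf => (hu' p hp hpf).1,
    mem_conductorOrder_of_forall_prime hf fun p hp hpf => (hu' p hp hpf).2⟩

theorem exists_unit_mul_mem_of_admissibleAt (hx : AdmissibleAt f x) :
    ∃ u : Rˣ, u * x ∈ conductorOrder R f := by
  obtain ⟨u, hu, -⟩ := exists_unit_mul_mem_and_inv_mul_mem hf hunits hx admissibleAt_self
    (mem_conductorOrder_of_dvd (dvd_mul_left _ _))
  exact ⟨u, hu⟩

end UnitMultiples

theorem inv_mem_conductorOrder (hf : Squarefree f) (u : Rˣ) (hu : ↑u ∈ conductorOrder R f) :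
    ↑u⁻¹ ∈ conductorOrder R f :=
  mem_conductorOrder_of_forall_prime hf fun p hp hpf =>
    mem_conductorOrder_of_mul_mem hp (conductorOrder_le_of_dvd hpf hu) ⟨↑u⁻¹, 0, by simp⟩
      (by simp)

theorem isUnit_conductorOrder_iff (hf : Squarefree f) {a : conductorOrder R f} :
    IsUnit a ↔ IsUnit (a : R) := by
  refine ⟨fun h => h.map (conductorOrder R f).subtype, fun ⟨u, hu⟩ => ?_⟩
  have huO := inv_mem_conductorOrder hf u (hu ▸ a.2)
  exact IsUnit.of_mul_eq_one ⟨_, huO⟩ (Subtype.ext (by simp [← hu]))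

end ConductorOrder

section Distances

variable {H B : Type*} [CommMonoid H] [AddCommMonoid B]

theorem isLeast_monoidDistances_two
    (hconsec : ∀ (b : H) (k : ℕ), k ∈ lengths H b → k + 1 ∉ lengths H b)
    {a : H} {k : ℕ} (hk : k ∈ lengths H a) (hk2 : k + 2 ∈ lengths H a) :
    IsLeast (monoidDistances H) 2 := by
  constructor
  · refine Set.mem_iUnion.2 ⟨a, two_pos, k, hk, Set.ext fun j => ?_⟩
    simp only [Set.mem_inter_iff, Set.mem_Icc, Set.mem_insert_iff, Set.mem_singleton_iff]
    constructor
    · rintro ⟨hj, hkj, hjk⟩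
      have : j ≠ k + 1 := fun h => hconsec a k hk (h ▸ hj)
      omega
    · rintro (rfl | rfl)
      · exact ⟨hk, le_rfl, Nat.le_add_right _ _⟩
      · exact ⟨hk2, Nat.le_add_right _ _, le_rfl⟩
  · intro δ hδ
    obtain ⟨b, hδ0, j, hj, hjδ⟩ := Set.mem_iUnion.1 hδ
    by_contra hlt
    obtain rfl : δ = 1 := by omega
    have hj1 : j + 1 ∈ lengths H b ∩ Set.Icc j (j + 1) := hjδ ▸ Or.inr rfl
    exact hconsec b j hj hj1.1

theorem irreducible_associatesMk_iff {a : H} : Irreducible (Associates.mk a) ↔ Irreducible a := by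
  simp only [irreducible_iff, Associates.isUnit_mk, Associates.forall_associated,
    Associates.mk_mul_mk, Associates.mk_eq_mk_iff_associated]
  refine and_congr_right fun ha => ⟨fun h b c hbc => h b c (hbc ▸ .rfl), fun h b c hbc => ?_⟩
  exact (hbc.irreducible ⟨ha, h⟩).isUnit_or_isUnit rfl

/-- A transfer homomorphism from a monoid `H`, written multiplicatively, to a reduced monoid `B`,
written additively: it reflects units, and decompositions of the image lift to factorizations. In
contrast to the usual definition, surjectivity is not required. -/
structure IsTransferHom (θ : H → B) : Prop where
  map_mul : ∀ a b, θ (a * b) = θ a + θ b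
  map_eq_zero : ∀ a, θ a = 0 ↔ IsUnit a
  split : ∀ a b c, θ a = b + c → ∃ x y, a = x * y ∧ θ x = b ∧ θ y = c

namespace IsTransferHom

variable {θ : H → B} (hθ : IsTransferHom θ)

include hθ

theorem map_eq_of_associated {a b : H} (h : Associated a b) : θ a = θ b := by
  obtain ⟨u, rfl⟩ := h
  rw [hθ.map_mul, (hθ.map_eq_zero u).2 u.isUnit, add_zero]

variable [Subsingleton (AddUnits B)]

theorem addIrreducible_map_iff {a : H} : AddIrreducible (θ a) ↔ Irreducible a := by
  simp only [addIrreducible_iff, irreducible_iff, isAddUnit_iff_eq_zero, hθ.map_eq_zero]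
  refine and_congr_right fun _ => ⟨fun h x y hxy => ?_, fun h b c hbc => ?_⟩
  · have hθxy : θ a = θ x + θ y := hxy ▸ hθ.map_mul x y
    simpa only [hθ.map_eq_zero] using h hθxy
  · obtain ⟨x, y, rfl, rfl, rfl⟩ := hθ.split a b c hbc
    simpa only [hθ.map_eq_zero] using h rfl

theorem mem_lengths_iff {a : H} {k : ℕ} :
    k ∈ lengths H a ↔
      ∃ s : Multiset B, (∀ b ∈ s, AddIrreducible b) ∧ s.sum = θ a ∧ s.card = k := by
  constructor
  · rintro ⟨z, ⟨hz, hza⟩, rfl⟩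
    induction z using Multiset.induction_on generalizing a with
    | empty =>
      refine ⟨0, by simp, ?_, rfl⟩
      rw [Multiset.sum_zero, eq_comm, hθ.map_eq_zero, ← Associates.isUnit_mk, ← hza]
      exact isUnit_one
    | cons u z ih =>
      obtain ⟨x, rfl⟩ := Associates.mk_surjective u
      obtain ⟨y, hy⟩ := Associates.mk_surjective z.prod
      obtain ⟨s, hs, hsy, hsz⟩ := ih (fun v hv => hz v (Multiset.mem_cons_of_mem hv)) hy.symm
      have hx : Irreducible x := irreducible_associatesMk_iff.1 (hz _ (Multiset.mem_cons_self _ _))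
      rw [Multiset.prod_cons, ← hy, Associates.mk_mul_mk,
        Associates.mk_eq_mk_iff_associated] at hza
      refine ⟨θ x ::ₘ s, Multiset.forall_mem_cons.2 ⟨hθ.addIrreducible_map_iff.2 hx, hs⟩, ?_, ?_⟩
      · rw [Multiset.sum_cons, hsy, ← hθ.map_mul, hθ.map_eq_of_associated hza]
      · rw [Multiset.card_cons, Multiset.card_cons, hsz]
  · rintro ⟨s, hs, hsa, rfl⟩
    induction s using Multiset.induction_on generalizing a with
    | empty =>
      rw [Multiset.sum_zero, eq_comm, hθ.map_eq_zero, ← Associates.mk_eq_one] at hsa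
      exact ⟨0, ⟨by simp, hsa.symm⟩, rfl⟩
    | cons b s ih =>
      rw [Multiset.sum_cons] at hsa
      obtain ⟨x, y, rfl, rfl, hy⟩ := hθ.split _ _ _ hsa.symm
      obtain ⟨hx, hs⟩ := Multiset.forall_mem_cons.1 hs
      obtain ⟨z, ⟨hz, hzy⟩, hzs⟩ := ih hs hy.symm
      refine ⟨Associates.mk x ::ₘ z, ⟨Multiset.forall_mem_cons.2 ⟨?_, hz⟩, ?_⟩, ?_⟩
      · exact irreducible_associatesMk_iff.2 (hθ.addIrreducible_map_iff.1 hx)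
      · rw [Multiset.prod_cons, hzy, Associates.mk_mul_mk]
      · rw [Multiset.card_cons, Multiset.card_cons, hzs]

theorem map_eq_two_mul_of_mem_lengths {w : B →+ ZMod 4} (hw : ∀ b, AddIrreducible b → w b = 2)
    {a : H} {k : ℕ} (hk : k ∈ lengths H a) : w (θ a) = 2 * k := by
  obtain ⟨s, hs, hsa, rfl⟩ := hθ.mem_lengths_iff.1 hk
  rw [← hsa, map_multiset_sum, Multiset.map_congr rfl fun b hb => hw b (hs b hb),
    Multiset.map_const', Multiset.sum_replicate, nsmul_eq_mul, mul_comm]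

theorem add_one_notMem_lengths {w : B →+ ZMod 4} (hw : ∀ b, AddIrreducible b → w b = 2)
    {a : H} {k : ℕ} (hk : k ∈ lengths H a) : k + 1 ∉ lengths H a := by
  intro hk1
  have h := (hθ.map_eq_two_mul_of_mem_lengths hw hk).symm.trans
    (hθ.map_eq_two_mul_of_mem_lengths hw hk1)
  have h2 : (2 : ZMod 4) = 0 := by
    push_cast at h
    linear_combination -h
  exact absurd h2 (by decide)

end IsTransferHom

end Distances

section BalancedMultisets

variable {ι : Type*}

open Classical in
/-- The multisets in which no element of `S` has multiplicity exactly one. -/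
def withoutSimple (S : ι → Prop) : AddSubmonoid (Multiset ι) where
  carrier := {M | ∀ x, S x → M.count x ≠ 1}
  zero_mem' := by simp
  add_mem' {M M'} hM hM' x hx := by
    have := hM x hx
    have := hM' x hx
    rw [Multiset.count_add]
    omega

open Classical in
/-- The multisets with an even number of elements of `N` in which no element of `S` has
multiplicity exactly one. If `N` is the set of nonprincipal primes and `S` the set of ramified
primes dividing the conductor, these are the factorizations of the principal ideals generated by
the elements of the order. -/
def balancedMultisets (N S : ι → Prop) : AddSubmonoid (Multiset ι) where
  carrier := {M | M ∈ withoutSimple S ∧ Even (M.countP N)}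
  zero_mem' := ⟨zero_mem _, by simp⟩
  add_mem' hM hM' := ⟨add_mem hM.1 hM'.1, by rw [Multiset.countP_add]; exact hM.2.add hM'.2⟩

open Classical in
/-- The weight in `ZMod 4` of a multiset, for which all atoms of `balancedMultisets N S` have weight
`2`. -/
noncomputable def weight (N S : ι → Prop) : Multiset ι →+ ZMod 4 :=
  Multiset.sumAddMonoidHom.comp <|
    Multiset.mapAddMonoidHom fun x => if S x then 3 else if N x then 1 else 2

instance (N S : ι → Prop) : Subsingleton (AddUnits (balancedMultisets N S)) :=
  (AddUnits.map_injective (f := (balancedMultisets N S).subtype)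
    Subtype.coe_injective).subsingleton

variable {N S : ι → Prop} {M : Multiset ι}

open Classical in
theorem weight_singleton (x : ι) :
    weight N S {x} = if S x then 3 else if N x then 1 else 2 := by
  simp [weight]

open Classical in
theorem two_mul_weight (hSN : ∀ x, S x → N x) (M : Multiset ι) :
    2 * weight N S M = 2 * M.countP N := by
  induction M using Multiset.induction_on with
  | empty => simp
  | cons x M ih =>
    have hx : 2 * weight N S {x} = if N x then 2 else 0 := by
      rw [weight_singleton]
      have := hSN x
      split_ifs <;> first | decide | tauto
    rw [← Multiset.singleton_add, map_add, mul_add, ih, hx, Multiset.countP_add,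
      ← Multiset.cons_zero, Multiset.countP_cons]
    push_cast
    split_ifs <;> simp [mul_add]

theorem mem_balancedMultisets_iff (hSN : ∀ x, S x → N x) :
    M ∈ balancedMultisets N S ↔ M ∈ withoutSimple S ∧ 2 * weight N S M = 0 := by
  classical
  refine and_congr_right fun _ => ?_
  rw [two_mul_weight hSN, show (2 : ZMod 4) * M.countP N = (2 * M.countP N : ℕ) by push_cast; rfl,
    ZMod.natCast_eq_zero_iff, even_iff_two_dvd]
  omega

open Classical in
theorem replicate_mem_and_sub_mem_withoutSimple {x : ι} {k : ℕ} (hk : k ≤ M.count x)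
    (hM : M ∈ withoutSimple S) (hSk : S x → k ≠ 1 ∧ M.count x ≠ k + 1) :
    Multiset.replicate k x ∈ withoutSimple S ∧ M - Multiset.replicate k x ∈ withoutSimple S := by
  refine ⟨fun y hy => ?_, fun y hy => ?_⟩
  · rw [Multiset.count_replicate]
    split_ifs with hxy
    · exact (hSk (hxy ▸ hy)).1
    · exact zero_ne_one
  · have hMy := hM y hy
    rw [Multiset.count_sub, Multiset.count_replicate]
    split_ifs with hxy
    · subst hxy
      have := (hSk hy).2
      omega
    · exact hMy

theorem exists_eq_add_of_ne_zero (hM : M ∈ withoutSimple S) (hM0 : M ≠ 0) :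
    ∃ A ∈ withoutSimple S, ∃ B ∈ withoutSimple S,
      M = A + B ∧ A ≠ 0 ∧ (weight N S A = 1 ∨ weight N S A = 2) := by
  classical
  obtain ⟨x, hx⟩ := Multiset.exists_mem_of_ne_zero hM0
  obtain ⟨k, hk0, hkM, hSk, hw⟩ : ∃ k ≠ 0, k ≤ M.count x ∧ (S x → k ≠ 1 ∧ M.count x ≠ k + 1) ∧
      (weight N S (Multiset.replicate k x) = 1 ∨ weight N S (Multiset.replicate k x) = 2) := by
    have hx1 := Multiset.one_le_count_iff_mem.2 hx
    simp only [← Multiset.nsmul_singleton, map_nsmul, weight_singleton]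
    by_cases hSx : S x
    · have hx2 := hM x hSx
      simp only [hSx, if_true]
      by_cases hx3 : M.count x = 3
      · exact ⟨3, by decide, by omega, fun _ => by omega, by decide⟩
      · exact ⟨2, by decide, by omega, fun _ => by omega, by decide⟩
    · refine ⟨1, one_ne_zero, hx1, fun h => (hSx h).elim, ?_⟩
      simp only [hSx, if_false, one_smul]
      split_ifs <;> simp
  obtain ⟨hA, hB⟩ := replicate_mem_and_sub_mem_withoutSimple hkM hM hSk
  refine ⟨_, hA, _, hB, ?_, ?_, hw⟩
  · exact (add_tsub_cancel_of_le (Multiset.le_count_iff_replicate_le.1 hkM)).symm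
  · simpa [← Multiset.card_eq_zero] using hk0

theorem weight_eq_two_of_addIrreducible (hSN : ∀ x, S x → N x) {M : balancedMultisets N S}
    (hM : AddIrreducible M) : weight N S M = 2 := by
  have hsplit {A B : Multiset ι} (hA : A ∈ withoutSimple S) (hB : B ∈ withoutSimple S)
      (hMAB : (M : Multiset ι) = A + B) (hA2 : 2 * weight N S A = 0) : A = 0 ∨ B = 0 := by
    have hB2 : 2 * weight N S B = 0 := by
      have := ((mem_balancedMultisets_iff hSN).1 M.2).2
      rwa [hMAB, map_add, mul_add, hA2, zero_add] at this
    have := hM.isAddUnit_or_isAddUnit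
      (a := ⟨A, (mem_balancedMultisets_iff hSN).2 ⟨hA, hA2⟩⟩)
      (b := ⟨B, (mem_balancedMultisets_iff hSN).2 ⟨hB, hB2⟩⟩) (Subtype.ext hMAB)
    simpa only [isAddUnit_iff_eq_zero, AddSubmonoid.mk_eq_zero] using this
  obtain ⟨hMS, hM2⟩ := (mem_balancedMultisets_iff hSN).1 M.2
  have hM0 : (M : Multiset ι) ≠ 0 := fun h => hM.ne_zero (Subtype.ext h)
  obtain ⟨A, hA, B, hB, hMAB, hA0, hwA | hwA⟩ := exists_eq_add_of_ne_zero (N := N) hMS hM0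
  · have hB0 : B ≠ 0 := by
      rintro rfl
      rw [hMAB, add_zero, hwA] at hM2
      exact absurd hM2 (by decide)
    obtain ⟨C, hC, D, hD, rfl, hC0, hwC | hwC⟩ := exists_eq_add_of_ne_zero (N := N) hB hB0
    · have hAC : weight N S (A + C) = 2 := by rw [map_add, hwA, hwC]; decide
      obtain h | rfl := hsplit (add_mem hA hC) hD (by rw [hMAB, add_assoc]) (by rw [hAC]; decide)
      · exact absurd (add_eq_zero.1 h).1 hA0
      · rw [hMAB, add_zero, hAC]
    · obtain h | h := hsplit hC (add_mem hA hD) (by rw [hMAB, add_left_comm]) (by rw [hwC]; decide)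
      · exact absurd h hC0
      · exact absurd (add_eq_zero.1 h).1 hA0
  · obtain rfl := (hsplit hA hB hMAB (by rw [hwA]; decide)).resolve_left hA0
    rw [hMAB, add_zero, hwA]

theorem addIrreducible_of_forall_even_card {M : balancedMultisets N S}
    (hN : ∀ x ∈ (M : Multiset ι), N x) (hM0 : (M : Multiset ι) ≠ 0)
    (h : ∀ A ∈ balancedMultisets N S, ∀ B ∈ balancedMultisets N S, (M : Multiset ι) = A + B →
      Even A.card → A.card = 0 ∨ B.card = 0) : AddIrreducible M := by
  classical
  refine addIrreducible_iff.2 ⟨fun hM => hM0 ?_, fun A B hAB => ?_⟩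
  · rw [isAddUnit_iff_eq_zero.1 hM, ZeroMemClass.coe_zero]
  · have hA : Even A.1.card := by
      have hAM : (A : Multiset ι) ≤ M := hAB ▸ Multiset.le_add_right _ _
      rw [← Multiset.countP_eq_card.2 fun x hx => hN x (Multiset.mem_of_le hAM hx)]
      exact A.2.2
    simpa only [isAddUnit_iff_eq_zero, Multiset.card_eq_zero, ZeroMemClass.coe_eq_zero] using
      h A A.2 B B.2 (hAB ▸ rfl) hA

theorem addIrreducible_of_eq_pair {M : balancedMultisets N S} {x : ι} (hx : N x)
    (hM : (M : Multiset ι) = {x, x}) : AddIrreducible M := by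
  refine addIrreducible_of_forall_even_card (by simp [hM, hx]) (by simp [hM])
    fun A _ B _ hAB hA => ?_
  have hcard := congrArg Multiset.card hAB
  rw [hM, Multiset.card_add, Multiset.card_pair] at hcard
  grind

theorem addIrreducible_of_eq_replicate_three_add {M : balancedMultisets N S} {x y : ι}
    (hx : S x) (hNx : N x) (hy : N y) (hxy : x ≠ y)
    (hM : (M : Multiset ι) = Multiset.replicate 3 x + {y}) : AddIrreducible M := by
  classical
  refine addIrreducible_of_forall_even_card (by simp [hM, hNx, hy, or_imp, forall_and])
    (by simp [hM]) fun A hAS B hBS hAB hA => ?_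
  rw [hM] at hAB
  have hcard := congrArg Multiset.card hAB
  have hcount := congrArg (Multiset.count x) hAB
  simp only [Multiset.card_add, Multiset.card_replicate, Multiset.card_singleton] at hcard
  simp only [Multiset.count_add, Multiset.count_replicate_self, Multiset.count_singleton,
    hxy, if_false] at hcount
  have := hAS.1 x hx
  have := hBS.1 x hx
  have := Multiset.count_le_card x A
  have := Multiset.count_le_card x B
  grind

theorem pair_mem_balancedMultisets {x : ι} (hx : N x) : {x, x} ∈ balancedMultisets N S := by
  classical
  refine ⟨fun y _ => ?_, ?_⟩
  · rw [Multiset.insert_eq_cons, Multiset.count_cons, Multiset.count_singleton]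
    split_ifs <;> decide
  · rw [Multiset.countP_eq_card.2 (by simp [hx]), Multiset.card_pair]
    exact even_two

theorem replicate_three_add_mem_balancedMultisets {x y : ι} (hx : N x) (hy : N y) (hyS : ¬ S y) :
    Multiset.replicate 3 x + {y} ∈ balancedMultisets N S := by
  classical
  refine ⟨fun z hz => ?_, ?_⟩
  · have hzy : z ≠ y := fun h => hyS (h ▸ hz)
    rw [Multiset.count_add, Multiset.count_replicate, Multiset.count_singleton, if_neg hzy]
    split_ifs <;> decide
  · rw [Multiset.countP_eq_card.2 (by simp [hx, hy, or_imp, forall_and]), Multiset.card_add,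
      Multiset.card_replicate, Multiset.card_singleton]
    decide

theorem isLeast_monoidDistances_of_isTransferHom {H : Type*} [CommMonoid H]
    {θ : H → balancedMultisets N S} (hθ : IsTransferHom θ) (hSN : ∀ x, S x → N x) {x y : ι}
    (hx : S x) (hy : N y) (hyS : ¬ S y) {a : H}
    (ha : (θ a : Multiset ι) = Multiset.replicate 3 x + {y}) : IsLeast (monoidDistances H) 2 := by
  have hNx := hSN x hx
  have hxy : x ≠ y := fun h => hyS (h ▸ hx)
  let X : balancedMultisets N S := ⟨{x, x}, pair_mem_balancedMultisets hNx⟩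
  let Y : balancedMultisets N S := ⟨{y, y}, pair_mem_balancedMultisets hy⟩
  have hX : AddIrreducible X := addIrreducible_of_eq_pair hNx rfl
  have hY : AddIrreducible Y := addIrreducible_of_eq_pair hy rfl
  have hθa : AddIrreducible (θ a) := addIrreducible_of_eq_replicate_three_add hx hNx hy hxy ha
  refine isLeast_monoidDistances_two (a := a * a) (k := 2) (fun b k => hθ.add_one_notMem_lengths
    (w := (weight N S).comp (balancedMultisets N S).subtype)
    fun M => weight_eq_two_of_addIrreducible hSN) ?_ ?_
  · exact hθ.mem_lengths_iff.2 ⟨{θ a, θ a}, by simp [hθa], by simp [hθ.map_mul], rfl⟩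
  · refine hθ.mem_lengths_iff.2 ⟨{X, X, X, Y}, by simp [hX, hY], ?_, rfl⟩
    rw [hθ.map_mul]
    apply Subtype.ext
    have hsum : ({x, x} + ({x, x} + ({x, x} + {y, y})) : Multiset ι) =
        (Multiset.replicate 3 x + {y}) + (Multiset.replicate 3 x + {y}) := by
      simp only [Multiset.insert_eq_cons, ← Multiset.singleton_add, ← Multiset.nsmul_singleton]
      abel
    simpa [X, Y, ha] using hsum

end BalancedMultisets

section QuadraticCoordinates

variable {K : Type*} [Field K]

theorem eq_conductorOrder_of_orderConductor_eq {ω : 𝓞 K}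
    (hω : ∀ x : 𝓞 K, ∃ a b : ℤ, x = a + b * ω) {f : ℕ} {O : Subring (𝓞 K)}
    (hO : orderConductor O = Ideal.span {(f : 𝓞 K)}) : O = conductorOrder (𝓞 K) f := by
  have hmem (x : 𝓞 K) : (∀ y, x * y ∈ O) ↔ (f : 𝓞 K) ∣ x := by
    rw [← Ideal.mem_span_singleton, ← hO]
    rfl
  have hf : ∀ y : 𝓞 K, f * y ∈ O := (hmem f).2 dvd_rfl
  refine le_antisymm (fun x hx => ?_) fun x hx => ?_
  · obtain ⟨a, b, rfl⟩ := hω x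
    have hbω : b * ω ∈ O := by simpa using sub_mem hx (intCast_mem O a)
    have hgω : (Int.gcd f b : 𝓞 K) * ω ∈ O := by
      have hbezout : (Int.gcd f b : 𝓞 K) = f * Int.gcdA f b + b * Int.gcdB f b := by
        exact_mod_cast congrArg (Int.cast : ℤ → 𝓞 K) (Int.gcd_eq_gcd_ab f b)
      rw [hbezout, add_mul, mul_assoc, mul_right_comm]
      exact add_mem (hf _) (mul_mem hbω (intCast_mem O _))
    have hfg : (f : 𝓞 K) ∣ (Int.gcd f b : 𝓞 K) := by
      refine (hmem _).1 fun y => ?_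
      obtain ⟨k, l, rfl⟩ := hω y
      rw [mul_add, mul_left_comm]
      exact add_mem (mul_mem (natCast_mem O _) (intCast_mem O _)) (mul_mem (intCast_mem O _) hgω)
    refine mem_conductorOrder_iff.2 ⟨a, ?_⟩
    rw [add_sub_cancel_left]
    exact (hfg.trans (natCast_dvd_intCast (Int.gcd_dvd_right _ _))).mul_right ω
  · obtain ⟨a, y, hy⟩ := mem_conductorOrder_iff.1 hx
    rw [sub_eq_iff_eq_add] at hy
    exact hy ▸ add_mem (hf y) (intCast_mem O a)

theorem not_isSquare_of_squarefree {d : ℕ} (hd : 2 ≤ d) (hdsq : Squarefree d) : ¬ IsSquare d := by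
  rintro ⟨r, rfl⟩
  have hr : r = 1 := Nat.isUnit_iff.1 (hdsq r dvd_rfl)
  simp [hr] at hd

theorem finrank_eq_two_of_sq_eq [CharZero K] {d : ℕ} (hd : ¬ IsSquare d) {s : K}
    (hs : s ^ 2 = (d : K)) (htop : IntermediateField.adjoin ℚ {s} = ⊤) :
    Module.finrank ℚ K = 2 := by
  have hnot (b : ℚ) (hb : b ^ 2 = (d : ℚ)) : False :=
    hd (Rat.isSquare_natCast_iff.1 ⟨b, by rw [← hb, sq]⟩)
  have hmin : Polynomial.X ^ 2 - Polynomial.C (d : ℚ) = minpoly ℚ s :=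
    minpoly.eq_of_irreducible_of_monic (X_pow_sub_C_irreducible_of_prime Nat.prime_two hnot)
      (by simp [hs]) (Polynomial.monic_X_pow_sub_C _ two_ne_zero)
  have hint : IsIntegral ℚ s := .of_pow two_pos (hs ▸ isIntegral_natCast d)
  have h := IntermediateField.adjoin.finrank hint
  rwa [← hmin, Polynomial.natDegree_X_pow_sub_C, htop, IntermediateField.finrank_top'] at h

theorem exists_ringEquiv_quadraticAlgebra {ω : 𝓞 K}
    (hω : Function.Bijective fun c : ℤ × ℤ => (c.1 : 𝓞 K) + c.2 * ω) :
    ∃ n t : ℤ, Nonempty (𝓞 K ≃+* QuadraticAlgebra ℤ n t) := by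
  obtain ⟨⟨n, t⟩, hnt⟩ := hω.2 (ω * ω)
  let φ : QuadraticAlgebra ℤ n t →ₐ[ℤ] 𝓞 K :=
    QuadraticAlgebra.lift ⟨ω, by simpa only [Algebra.algebraMap_eq_smul_one, zsmul_eq_mul, mul_one]
      using hnt.symm⟩
  have hφ (z : QuadraticAlgebra ℤ n t) : φ z = z.re + z.im * ω := by
    simp [φ, QuadraticAlgebra.lift]
  refine ⟨n, t, ⟨(RingEquiv.ofBijective φ ⟨fun y z hyz => ?_, fun x => ?_⟩).symm⟩⟩
  · rw [hφ, hφ] at hyz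
    have := @hω.1 (y.re, y.im) (z.re, z.im) hyz
    exact QuadraticAlgebra.ext (congrArg Prod.fst this) (congrArg Prod.snd this)
  · obtain ⟨c, hc⟩ := hω.2 x
    exact ⟨⟨c.1, c.2⟩, (hφ _).trans hc⟩

variable [NumberField K]

theorem exists_eq_intCast_of_intCast_mul_eq {m k : ℤ} (hm : m ≠ 0) {x : 𝓞 K} (h : m * x = k) :
    ∃ l : ℤ, (l : 𝓞 K) = x := by
  have hx : algebraMap ℚ K (k / m) = x := by
    have hm' : (m : K) ≠ 0 := Int.cast_ne_zero.2 hm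
    rw [map_div₀, map_intCast, map_intCast, div_eq_iff hm', mul_comm]
    simpa using (congrArg (algebraMap (𝓞 K) K) h).symm
  have hint : IsIntegral ℤ ((k : ℚ) / m) :=
    (isIntegral_algebraMap_iff (algebraMap ℚ K).injective).1 (hx ▸ x.2)
  obtain ⟨l, hl⟩ := IsIntegrallyClosed.isIntegral_iff.1 hint
  refine ⟨l, NumberField.RingOfIntegers.ext ?_⟩
  rw [← hx, ← hl]
  simp

theorem exists_surjective_linearMap_apply_eq_zero_iff (h : Module.finrank ℚ K = 2) :
    ∃ g : 𝓞 K →ₗ[ℤ] ℤ, Function.Surjective g ∧ ∀ x, g x = 0 ↔ ∃ a : ℤ, (a : 𝓞 K) = x := by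
  let Z : Submodule ℤ (𝓞 K) := Submodule.span ℤ {1}
  have hmem (x : 𝓞 K) : x ∈ Z ↔ ∃ a : ℤ, (a : 𝓞 K) = x := by
    simp only [Z, Submodule.mem_span_singleton, zsmul_one]
  have : Module.IsTorsionFree ℤ (𝓞 K ⧸ Z) := by
    refine .of_smul_eq_zero fun m q hq => or_iff_not_imp_left.2 fun hm => ?_
    obtain ⟨x, rfl⟩ := Z.mkQ_surjective q
    rw [← map_smul, Submodule.mkQ_apply, Submodule.Quotient.mk_eq_zero, hmem, zsmul_eq_mul] at hq
    obtain ⟨k, hk⟩ := hq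
    exact (Submodule.Quotient.mk_eq_zero Z).2
      ((hmem x).2 (exists_eq_intCast_of_intCast_mul_eq hm hk.symm))
  have hrank : Module.finrank ℤ (𝓞 K ⧸ Z) = 1 := by
    have hZ : Module.finrank ℤ Z = 1 := by
      rw [← (LinearEquiv.toSpanNonzeroSingleton ℤ (𝓞 K) 1 one_ne_zero).finrank_eq,
        Module.finrank_self]
    have hadd := Submodule.finrank_quotient_add_finrank Z
    rw [NumberField.RingOfIntegers.rank, h, hZ] at hadd
    exact Nat.succ_injective hadd
  let e : (𝓞 K ⧸ Z) ≃ₗ[ℤ] ℤ :=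
    LinearEquiv.ofFinrankEq _ _ (hrank.trans (Module.finrank_self ℤ).symm)
  refine ⟨e ∘ₗ Z.mkQ, e.surjective.comp Z.mkQ_surjective, fun x => ?_⟩
  rw [← hmem, LinearMap.comp_apply, LinearEquiv.coe_coe, e.map_eq_zero_iff, Submodule.mkQ_apply,
    Submodule.Quotient.mk_eq_zero]

theorem exists_bijective_intCast_add_intCast_mul (h : Module.finrank ℚ K = 2) :
    ∃ ω : 𝓞 K, Function.Bijective fun c : ℤ × ℤ => (c.1 : 𝓞 K) + c.2 * ω := by
  obtain ⟨g, hg, hker⟩ := exists_surjective_linearMap_apply_eq_zero_iff h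
  obtain ⟨ω, hω⟩ := hg 1
  have hcoord (a b : ℤ) : g (a + b * ω) = b := by
    rw [map_add, (hker a).2 ⟨a, rfl⟩, ← zsmul_eq_mul, map_smul, hω, zero_add, smul_eq_mul, mul_one]
  refine ⟨ω, fun ⟨a, b⟩ ⟨k, l⟩ hab => ?_, fun x => ?_⟩
  · obtain rfl : b = l := by simpa only [hcoord] using congrArg g hab
    simpa using hab
  · obtain ⟨a, ha⟩ := (hker (x - g x * ω)).1 (by
      rw [map_sub, ← zsmul_eq_mul, map_smul, hω, smul_eq_mul, mul_one, sub_self])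
    exact ⟨(a, g x), by simp only [ha, sub_add_cancel]⟩

end QuadraticCoordinates

section PicardGroup

theorem card_classGroup_eq_card_pic (R : Type*) [CommRing R] [IsDomain R] :
    Nat.card (ClassGroup R) = Nat.card (CommRing.Pic R) :=
  Nat.card_congr (ClassGroup.equivPic R).toEquiv

theorem isUnit_coeIdeal_of_mul_eq_span_singleton {S : Type*} [CommRing S] [IsDomain S]
    {I J : Ideal S} {c : S} (hc : c ≠ 0) (h : I * J = Ideal.span {c}) :
    IsUnit (I : FractionalIdeal S⁰ (FractionRing S)) := by
  have hIJ : (I : FractionalIdeal S⁰ (FractionRing S)) * J =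
      FractionalIdeal.spanSingleton S⁰ (algebraMap S (FractionRing S) c) := by
    rw [← FractionalIdeal.coeIdeal_mul, h, FractionalIdeal.coeIdeal_span_singleton]
  refine isUnit_of_mul_isUnit_left (y := (J : FractionalIdeal S⁰ (FractionRing S))) (hIJ ▸ ?_)
  refine IsUnit.of_mul_eq_one
    (FractionalIdeal.spanSingleton S⁰ (algebraMap S (FractionRing S) c)⁻¹) ?_
  rw [FractionalIdeal.spanSingleton_mul_spanSingleton, mul_inv_cancel₀ (by simpa using hc),
    FractionalIdeal.spanSingleton_one]

variable {R : Type*} [CommRing R]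

theorem exists_mem_one_sub_mem {A F : Ideal R} (h : A ⊔ F = ⊤) : ∃ a ∈ A, 1 - a ∈ F := by
  obtain ⟨a, ha, g, hg, hag⟩ := Submodule.mem_sup.1 ((Ideal.eq_top_iff_one _).1 h)
  exact ⟨a, ha, (eq_sub_of_add_eq' hag) ▸ hg⟩

section Contraction

variable {O : Subring R} {F : Ideal R} (hF : ∀ x ∈ F, x ∈ O)

include hF

theorem mem_of_one_sub_mem {a : R} (ha : 1 - a ∈ F) : a ∈ O := by
  simpa using sub_mem O.one_mem (hF _ ha)

theorem exists_mem_comap_mul_comap_coe_eq_sq_mul {A B : Ideal R} {w z : R} (hw : w ∈ F)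
    (hz : z ∈ A * B) :
    ∃ y ∈ A.comap O.subtype * B.comap O.subtype, (y : R) = w ^ 2 * z := by
  have hwO (x : R) : w * x ∈ O := hF _ (F.mul_mem_right _ hw)
  induction hz using Submodule.mul_induction_on' with
  | mem_mul_mem x hx y hy =>
    refine ⟨⟨w * x, hwO x⟩ * ⟨w * y, hwO y⟩, Ideal.mul_mem_mul (A.mul_mem_left _ hx)
      (B.mul_mem_left _ hy), ?_⟩
    rw [Subring.coe_mul]
    ring
  | add x _ y _ hx hy =>
    obtain ⟨x', hx', hx''⟩ := hx
    obtain ⟨y', hy', hy''⟩ := hy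
    exact ⟨x' + y', add_mem hx' hy', by rw [Subring.coe_add, hx'', hy'', mul_add]⟩

theorem comap_subtype_mul {A B : Ideal R} (hA : A ⊔ F = ⊤) (hB : B ⊔ F = ⊤) :
    (A * B).comap O.subtype = A.comap O.subtype * B.comap O.subtype := by
  refine le_antisymm (fun z hz => ?_) (Ideal.le_comap_mul _)
  obtain ⟨a, ha, haF⟩ := exists_mem_one_sub_mem hA
  obtain ⟨b, hb, hbF⟩ := exists_mem_one_sub_mem hB
  have habF : 1 - a * b ∈ F := by
    rw [show 1 - a * b = (1 - a) + a * (1 - b) by ring]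
    exact add_mem haF (F.mul_mem_left _ hbF)
  let c : O := ⟨a, mem_of_one_sub_mem hF haF⟩ * ⟨b, mem_of_one_sub_mem hF hbF⟩
  have hc : c ∈ A.comap O.subtype * B.comap O.subtype := Ideal.mul_mem_mul ha hb
  obtain ⟨y, hy, hyz⟩ := exists_mem_comap_mul_comap_coe_eq_sq_mul hF habF hz
  have hzy : z = (1 + (1 - c)) * z * c + y := by
    refine Subtype.ext ?_
    rw [Subring.coe_add, hyz]
    push_cast
    simp only [c, Subring.subtype_apply, Subring.coe_mul]
    ring
  rw [hzy]
  exact add_mem (Ideal.mul_mem_left _ _ hc) hy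

theorem map_comap_subtype {A : Ideal R} (hA : A ⊔ F = ⊤) :
    (A.comap O.subtype).map O.subtype = A := by
  refine le_antisymm Ideal.map_comap_le fun z hz => ?_
  obtain ⟨a, ha, haF⟩ := exists_mem_one_sub_mem hA
  rw [show z = z * a + (1 - a) * z by ring]
  refine add_mem (Ideal.mul_mem_left _ _ ?_) ?_
  · exact Ideal.mem_map_of_mem O.subtype (I := A.comap O.subtype)
      (x := ⟨a, mem_of_one_sub_mem hF haF⟩) ha
  · exact Ideal.mem_map_of_mem O.subtype (I := A.comap O.subtype)
      (x := ⟨(1 - a) * z, hF _ (F.mul_mem_right _ haF)⟩) (A.mul_mem_left _ hz)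

theorem comap_subtype_span_singleton {c : O} (hc : 1 - (c : R) ∈ F) :
    (Ideal.span {(c : R)}).comap O.subtype = Ideal.span {c} := by
  refine le_antisymm (fun z hz => ?_) ?_
  · obtain ⟨r, hr : r * c = z⟩ := Ideal.mem_span_singleton'.1 (Ideal.mem_comap.1 hz)
    have hrO : r ∈ O := by
      rw [show r = z + r * (1 - c) by linear_combination hr]
      exact add_mem z.2 (hF _ (F.mul_mem_left _ hc))
    exact Ideal.mem_span_singleton'.2 ⟨⟨r, hrO⟩, Subtype.ext hr⟩
  · exact (Ideal.span_singleton_le_iff_mem _).2 (Ideal.mem_span_singleton_self (c : R))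

end Contraction

variable [IsDedekindDomain R] {O : Subring R} {F : Ideal R}

theorem exists_mul_eq_span_singleton_and_sup_eq_top {A : Ideal R} (hA : A ≠ 0) (hF : F ≠ 0) :
    ∃ (a : R) (B : Ideal R), A * B = Ideal.span {a} ∧ B ⊔ F = ⊤ := by
  obtain ⟨a, ha⟩ := IsDedekindDomain.exists_sup_span_eq (I := A * F) (J := A) Ideal.mul_le_left
    (mul_ne_zero hA hF)
  obtain ⟨B, hB⟩ := Ideal.dvd_iff_le.2 (le_sup_right.trans ha.le)
  refine ⟨a, B, hB.symm, mul_left_cancel₀ hA ?_⟩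
  rw [sup_comm, Ideal.mul_sup, ← hB, ha, Ideal.mul_top]

theorem exists_comap_mul_eq_span_singleton (hF : ∀ x ∈ F, x ∈ O) (hF0 : F ≠ 0) (hF1 : F ≠ ⊤)
    {A : Ideal R} (hA0 : A ≠ 0) (hA : A ⊔ F = ⊤) :
    ∃ (J : Ideal O) (c : O), c ≠ 0 ∧ A.comap O.subtype * J = Ideal.span {c} := by
  obtain ⟨a, B, hab, hB⟩ := exists_mul_eq_span_singleton_and_sup_eq_top hA0 hF0
  have ha : Ideal.span {a} ⊔ F = ⊤ := by rw [← hab, Ideal.mul_sup_eq_of_coprime_left hA, hB]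
  obtain ⟨c, hc, hcF⟩ := exists_mem_one_sub_mem ha
  obtain ⟨b, rfl⟩ := Ideal.mem_span_singleton.1 hc
  have hb : Ideal.span {b} ⊔ F = ⊤ := by
    rw [Ideal.eq_top_iff_one, ← add_sub_cancel (a * b) 1]
    exact add_mem (Ideal.mem_sup_left (Ideal.mul_mem_left _ _ (Ideal.mem_span_singleton_self b)))
      (Ideal.mem_sup_right hcF)
  have hBb : B * Ideal.span {b} ⊔ F = ⊤ := by rw [Ideal.mul_sup_eq_of_coprime_left hB, hb]
  refine ⟨(B * Ideal.span {b}).comap O.subtype, ⟨a * b, mem_of_one_sub_mem hF hcF⟩, ?_, ?_⟩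
  · intro h
    have hab0 : a * b = 0 := congrArg Subtype.val h
    rw [hab0, sub_zero] at hcF
    exact hF1 ((Ideal.eq_top_iff_one _).2 hcF)
  · rw [← comap_subtype_mul hF hA hBb, ← mul_assoc, hab, Ideal.span_singleton_mul_span_singleton]
    exact comap_subtype_span_singleton hF (c := ⟨a * b, mem_of_one_sub_mem hF hcF⟩) hcF

theorem exists_units_coe_eq_comap (hF : ∀ x ∈ F, x ∈ O) (hF0 : F ≠ 0) (hF1 : F ≠ ⊤)
    {A : Ideal R} (hA0 : A ≠ 0) (hA : A ⊔ F = ⊤) :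
    ∃ u : (FractionalIdeal O⁰ (FractionRing O))ˣ, (u : FractionalIdeal O⁰ (FractionRing O)) =
      (A.comap O.subtype : Ideal O) := by
  obtain ⟨J, c, hc, hJ⟩ := exists_comap_mul_eq_span_singleton hF hF0 hF1 hA0 hA
  exact isUnit_coeIdeal_of_mul_eq_span_singleton hc hJ

theorem mk0_eq_mk0_of_comap (hF : ∀ x ∈ F, x ∈ O) {A B : (Ideal R)⁰}
    (hA : (A : Ideal R) ⊔ F = ⊤) (hB : (B : Ideal R) ⊔ F = ⊤)
    {u v : (FractionalIdeal O⁰ (FractionRing O))ˣ}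
    (hu : (u : FractionalIdeal O⁰ (FractionRing O)) = ((A : Ideal R).comap O.subtype : Ideal O))
    (hv : (v : FractionalIdeal O⁰ (FractionRing O)) = ((B : Ideal R).comap O.subtype : Ideal O))
    (huv : ClassGroup.mk (FractionRing O) u = ClassGroup.mk (FractionRing O) v) :
    ClassGroup.mk0 A = ClassGroup.mk0 B := by
  obtain ⟨y, z, hy, hz, hyz⟩ := (ClassGroup.mk_eq_mk_of_coe_ideal hu hv).1 huv
  refine ClassGroup.mk0_eq_mk0_iff.2 ⟨y, z, by simpa using hy, by simpa using hz, ?_⟩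
  simpa only [Ideal.map_mul, Subring.subtype_apply, map_comap_subtype hF hA,
    map_comap_subtype hF hB, Ideal.map_span, Set.image_singleton] using
      congrArg (Ideal.map O.subtype) hyz

theorem exists_mk0_eq_and_sup_eq_top (hF0 : F ≠ 0) (hF1 : F ≠ ⊤) (c : ClassGroup R) :
    ∃ A : (Ideal R)⁰, ClassGroup.mk0 A = c ∧ (A : Ideal R) ⊔ F = ⊤ := by
  obtain ⟨J, hJ⟩ := ClassGroup.mk0_surjective c⁻¹
  obtain ⟨a, B, hab, hB⟩ :=
    exists_mul_eq_span_singleton_and_sup_eq_top (nonZeroDivisors.ne_zero J.2) hF0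
  have hB0 : B ∈ (Ideal R)⁰ := by
    refine mem_nonZeroDivisors_of_ne_zero fun h => hF1 ?_
    rwa [h, Ideal.zero_eq_bot, bot_sup_eq] at hB
  refine ⟨⟨B, hB0⟩, ?_, hB⟩
  have hJB : ClassGroup.mk0 (J * ⟨B, hB0⟩) = 1 :=
    (ClassGroup.mk0_eq_one_iff _).2 ⟨⟨a, hab⟩⟩
  rw [map_mul, hJ] at hJB
  exact (inv_mul_eq_one.1 hJB).symm

-- The classes `A ∩ O` with `A` coprime to `F` fill `Pic O`, since extension to `R` recovers `A`
-- and `Pic O` is no larger than `Pic R`; hence `x R ∩ O` is principal along with `x R`.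
theorem exists_unit_mul_mem_of_card_pic_le [Finite (CommRing.Pic O)] (hF : ∀ x ∈ F, x ∈ O)
    (hF0 : F ≠ 0) (hcard : Nat.card (CommRing.Pic O) ≤ Nat.card (CommRing.Pic R)) {x : R}
    (hx : Ideal.span {x} ⊔ F = ⊤) : ∃ u : Rˣ, u * x ∈ O := by
  by_cases hF1 : F = ⊤
  · exact ⟨1, hF _ (hF1 ▸ Submodule.mem_top)⟩
  have hx0 : Ideal.span {x} ≠ 0 := by
    intro h
    rw [h, Ideal.zero_eq_bot, bot_sup_eq] at hx
    exact hF1 hx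
  let X : (Ideal R)⁰ := ⟨Ideal.span {x}, mem_nonZeroDivisors_of_ne_zero hx0⟩
  have hX : ClassGroup.mk0 X = 1 := (ClassGroup.mk0_eq_one_iff _).2 ⟨⟨x, rfl⟩⟩
  choose A hA hAF using exists_mk0_eq_and_sup_eq_top hF0 hF1
  choose v hv using fun c =>
    exists_units_coe_eq_comap hF hF0 hF1 (nonZeroDivisors.ne_zero (A c).2) (hAF c)
  have hinj : Function.Injective fun c => ClassGroup.mk (FractionRing O) (v c) := fun c c' h => by
    rw [← hA c, ← hA c', mk0_eq_mk0_of_comap hF (hAF c) (hAF c') (hv c) (hv c') h]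
  have hmk {B : (Ideal R)⁰} (hBF : (B : Ideal R) ⊔ F = ⊤) (hB : ClassGroup.mk0 B = 1)
      {w : (FractionalIdeal O⁰ (FractionRing O))ˣ} (hw : (w : FractionalIdeal O⁰ (FractionRing O)) =
        ((B : Ideal R).comap O.subtype : Ideal O)) :
      ClassGroup.mk (FractionRing O) w = ClassGroup.mk (FractionRing O) (v 1) := by
    rw [← card_classGroup_eq_card_pic, ← card_classGroup_eq_card_pic] at hcard
    have := Finite.of_equiv _ (ClassGroup.equivPic O).symm.toEquiv
    obtain ⟨c, hc⟩ := (hinj.bijective_of_nat_card_le hcard).2 (ClassGroup.mk (FractionRing O) w)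
    rw [← hc, ← hB, ← mk0_eq_mk0_of_comap hF (hAF c) hBF (hv c) hw hc, hA]
  obtain ⟨w, hw⟩ := exists_units_coe_eq_comap hF hF0 hF1 hx0 hx
  have hw1 : ClassGroup.mk (FractionRing O) w = 1 := by
    rw [hmk (B := X) hx hX hw, ← hmk (B := 1) (w := 1) (by simp) (map_one _) (by simp), map_one]
  obtain ⟨y, -, hy⟩ := (ClassGroup.mk_eq_one_of_coe_ideal hw).1 hw1
  have hyx : Ideal.span {x} = Ideal.span {(y : R)} := by
    simpa only [hy, Ideal.map_span, Subring.subtype_apply, Set.image_singleton] using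
      (map_comap_subtype hF hx).symm
  obtain ⟨u, hu⟩ := Ideal.span_singleton_eq_span_singleton.1 hyx
  exact ⟨u, by rw [mul_comm, hu]; exact y.2⟩

end PicardGroup

section NormObstruction

theorem isSquare_neg_iff {q : ℕ} [Fact q.Prime] (hq : q % 4 = 1) {x : ZMod q} :
    IsSquare (-x) ↔ IsSquare x := by
  have hneg : IsSquare (-1 : ZMod q) := ZMod.exists_sq_eq_neg_one_iff.2 (by lia)
  exact ⟨fun h => by simpa using hneg.mul h, fun h => by simpa using hneg.mul h⟩

theorem isSquare_natAbs_iff {q : ℕ} [Fact q.Prime] (hq : q % 4 = 1) {z : ℤ} :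
    IsSquare (z.natAbs : ZMod q) ↔ IsSquare (z : ZMod q) := by
  rcases Int.natAbs_eq z with h | h
  · conv_rhs => rw [h, Int.cast_natCast]
  · conv_rhs => rw [h, Int.cast_neg, Int.cast_natCast, isSquare_neg_iff hq]

theorem not_natCast_dvd_two {p : ℕ} (hp : p.Prime) (hp2 : p ≠ 2) : ¬ (p : ℤ) ∣ 2 := fun h =>
  hp2 ((Nat.prime_dvd_prime_iff_eq hp Nat.prime_two).1 (by exact_mod_cast h))

open QuadraticAlgebra

variable {n t : ℤ} {x y : QuadraticAlgebra ℤ n t}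

theorem natCast_dvd_iff {m : ℕ} : (m : QuadraticAlgebra ℤ n t) ∣ x ↔
    (m : ℤ) ∣ x.re ∧ (m : ℤ) ∣ x.im := by
  simpa using algebraMap_dvd_iff (R := ℤ) (r := m) (z := x)

theorem natAbs_norm_unit (u : (QuadraticAlgebra ℤ n t)ˣ) :
    (u : QuadraticAlgebra ℤ n t).norm.natAbs = 1 :=
  Int.isUnit_iff_natAbs_eq.1 (u.isUnit.map QuadraticAlgebra.norm)

theorem isCoprime_natCast_of_isCoprime_norm {q : ℕ} (h : IsCoprime x.norm (q : ℤ)) :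
    IsCoprime x (q : QuadraticAlgebra ℤ n t) := by
  have hnorm := h.map (algebraMap ℤ (QuadraticAlgebra ℤ n t))
  rw [algebraMap_norm_eq_mul_star, map_natCast] at hnorm
  exact hnorm.of_mul_left_left

theorem dvd_norm_sub_norm {q : ℕ} (h : (q : QuadraticAlgebra ℤ n t) ∣ x - y) :
    (q : ℤ) ∣ x.norm - y.norm := by
  obtain ⟨z, hz⟩ := h
  obtain rfl := sub_eq_iff_eq_add'.1 hz
  refine ⟨z.re * (2 * y.re + t * y.im) + z.im * (t * y.re - 2 * n * y.im) + q * z.norm, ?_⟩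
  simp only [norm_def, re_add, im_add, re_mul, im_mul, re_natCast, im_natCast]
  ring

section Associated

variable {p : ℕ}

theorem natAbs_norm_of_associated_sq (h : Associated (p : QuadraticAlgebra ℤ n t) (x ^ 2)) :
    x.norm.natAbs = p := by
  obtain ⟨u, hu⟩ := h
  have hnorm := congrArg (fun z => z.norm.natAbs) hu
  simp only [map_mul, map_pow, QuadraticAlgebra.norm_natCast, Int.natAbs_mul,
    natAbs_norm_unit, Int.natAbs_pow, Int.natAbs_natCast, mul_one] at hnorm
  exact (Nat.pow_left_injective two_ne_zero hnorm).symm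

theorem not_natCast_dvd_of_natAbs_norm_eq (hp : p.Prime) (hx : x.norm.natAbs = p) :
    ¬ (p : QuadraticAlgebra ℤ n t) ∣ x := by
  rintro ⟨y, rfl⟩
  rw [map_mul, QuadraticAlgebra.norm_natCast, Int.natAbs_mul, Int.natAbs_pow, Int.natAbs_natCast,
    sq, mul_assoc, Nat.mul_eq_left hp.ne_zero] at hx
  exact hp.one_lt.ne' (Nat.eq_one_of_mul_eq_one_right hx)

theorem dvd_trace_of_associated_sq (hp : p.Prime)
    (h : Associated (p : QuadraticAlgebra ℤ n t) (x ^ 2)) : (p : ℤ) ∣ x.trace := by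
  have hx := natAbs_norm_of_associated_sq h
  have hdvd : (p : QuadraticAlgebra ℤ n t) ∣ x.trace • x := by
    have hnorm : (p : QuadraticAlgebra ℤ n t) ∣ algebraMap ℤ _ x.norm := by
      rw [eq_intCast]
      exact natCast_dvd_intCast (Int.natCast_dvd.2 hx.symm.dvd)
    have := h.dvd.add hnorm
    rwa [sq_eq_trace_smul_sub_norm, sub_add_cancel] at this
  rw [natCast_dvd_iff, re_smul, im_smul, smul_eq_mul, smul_eq_mul] at hdvd
  by_contra hp'
  have hpi := Nat.prime_iff_prime_int.1 hp
  exact not_natCast_dvd_of_natAbs_norm_eq hp hx (natCast_dvd_iff.2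
    ⟨(hpi.dvd_or_dvd hdvd.1).resolve_left hp', (hpi.dvd_or_dvd hdvd.2).resolve_left hp'⟩)

theorem dvd_discr_of_associated_sq (hp : p.Prime) (hp2 : p ≠ 2)
    (h : Associated (p : QuadraticAlgebra ℤ n t) (x ^ 2)) : (p : ℤ) ∣ t ^ 2 + 4 * n := by
  have hpi := Nat.prime_iff_prime_int.1 hp
  have hx := natAbs_norm_of_associated_sq h
  have htr := dvd_trace_of_associated_sq hp h
  have hdvd : (p : ℤ) ∣ (t ^ 2 + 4 * n) * x.im ^ 2 := by
    rw [show (t ^ 2 + 4 * n) * x.im ^ 2 = x.trace ^ 2 - 4 * x.norm by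
      rw [trace_def, norm_def]; ring]
    exact (dvd_pow htr two_ne_zero).sub ((Int.natCast_dvd.2 hx.symm.dvd).mul_left 4)
  refine (hpi.dvd_or_dvd hdvd).resolve_right fun him => ?_
  replace him := hpi.dvd_of_dvd_pow him
  have hre : (p : ℤ) ∣ 2 * x.re := by
    rw [trace_def] at htr
    exact (dvd_add_left (him.mul_left t)).1 htr
  exact not_natCast_dvd_of_natAbs_norm_eq hp hx (natCast_dvd_iff.2
    ⟨(hpi.dvd_or_dvd hre).resolve_left (not_natCast_dvd_two hp hp2), him⟩)

end Associated

section SquareRoot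

variable {d : ℕ} {s : QuadraticAlgebra ℤ n t} (hs : s ^ 2 = d)

include hs

theorem re_sq_add_mul_im_sq : s.re ^ 2 + n * s.im ^ 2 = d := by
  have h := congrArg re hs
  rw [sq, re_mul, re_natCast] at h
  linear_combination h

variable (hd : ¬ IsSquare d)

include hd

theorem im_ne_zero_of_sq_eq : s.im ≠ 0 := by
  intro h
  have hre := re_sq_add_mul_im_sq hs
  rw [h] at hre
  exact hd (Int.isSquare_natCast_iff.1 ⟨s.re, by linear_combination -hre⟩)

theorem trace_eq_zero_of_sq_eq : s.trace = 0 := by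
  have h := congrArg im hs
  rw [sq, im_mul, im_natCast] at h
  refine (mul_eq_zero.1 ?_).resolve_right (im_ne_zero_of_sq_eq hs hd)
  rw [trace_def]
  linear_combination h

theorem im_sq_mul_norm (x : QuadraticAlgebra ℤ n t) :
    s.im ^ 2 * x.norm = (s.im * x.re - s.re * x.im) ^ 2 - d * x.im ^ 2 := by
  have hre := re_sq_add_mul_im_sq hs
  have htr := trace_eq_zero_of_sq_eq hs hd
  rw [trace_def] at htr
  rw [norm_def]
  linear_combination -x.im ^ 2 * hre + s.im * x.re * x.im * htr

theorem four_mul_eq_im_sq_mul_discr : 4 * (d : ℤ) = s.im ^ 2 * (t ^ 2 + 4 * n) := by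
  have hre := re_sq_add_mul_im_sq hs
  have htr := trace_eq_zero_of_sq_eq hs hd
  rw [trace_def] at htr
  linear_combination (-4 : ℤ) * hre + (2 * s.re - t * s.im) * htr

theorem dvd_of_associated_sq {p : ℕ} (hp : p.Prime) (hp2 : p ≠ 2)
    (h : Associated (p : QuadraticAlgebra ℤ n t) (x ^ 2)) : p ∣ d := by
  have hpi := Nat.prime_iff_prime_int.1 hp
  have h4d : (p : ℤ) ∣ 4 * d := by
    rw [four_mul_eq_im_sq_mul_discr hs hd]
    exact (dvd_discr_of_associated_sq hp hp2 h).mul_left _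
  have h4 : ¬ (p : ℤ) ∣ 2 ^ 2 := fun h => not_natCast_dvd_two hp hp2 (hpi.dvd_of_dvd_pow h)
  exact Int.natCast_dvd_natCast.1 ((hpi.dvd_or_dvd h4d).resolve_left h4)

theorem exists_im_sq_mul_eq_of_norm_eq {p e : ℕ} (hp : p.Prime) (hde : d = p * e) {ε : ℤ}
    (hx : x.norm = p * ε) : ∃ c : ℤ, s.im ^ 2 * ε = p * c ^ 2 - e * x.im ^ 2 := by
  have hpi := Nat.prime_iff_prime_int.1 hp
  have hnorm := im_sq_mul_norm hs hd x
  rw [hx, hde] at hnorm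
  push_cast at hnorm
  obtain ⟨c, hc⟩ : (p : ℤ) ∣ s.im * x.re - s.re * x.im :=
    hpi.dvd_of_dvd_pow (n := 2) ⟨s.im ^ 2 * ε + e * x.im ^ 2, by linear_combination -hnorm⟩
  rw [hc] at hnorm
  exact ⟨c, mul_left_cancel₀ hpi.ne_zero (by linear_combination hnorm)⟩

variable (hdsq : Squarefree d)

include hdsq

theorem not_dvd_im_of_sq_eq {q : ℕ} (hq : q.Prime) (hq2 : q ≠ 2) : ¬ (q : ℤ) ∣ s.im := by
  intro him
  have htr := trace_eq_zero_of_sq_eq hs hd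
  rw [trace_def] at htr
  have h2re : (q : ℤ) ∣ 2 * s.re := by
    rw [eq_neg_of_add_eq_zero_left htr]
    exact (him.mul_left t).neg_right
  have hre : (q : ℤ) ∣ s.re := ((Nat.prime_iff_prime_int.1 hq).dvd_or_dvd h2re).resolve_left
    (not_natCast_dvd_two hq hq2)
  have hsq : (q : ℤ) * q ∣ d := by
    rw [← re_sq_add_mul_im_sq hs, sq, sq]
    exact (mul_dvd_mul hre hre).add ((mul_dvd_mul him him).mul_left n)
  exact hq.not_isUnit (hdsq q (by exact_mod_cast hsq))

theorem isSquare_norm_of_dvd {q : ℕ} [Fact q.Prime] (hq : q ≠ 2) (hqd : q ∣ d)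
    (x : QuadraticAlgebra ℤ n t) : IsSquare (x.norm : ZMod q) := by
  have him := not_dvd_im_of_sq_eq hs hd hdsq Fact.out hq
  rw [← ZMod.intCast_zmod_eq_zero_iff_dvd] at him
  have hnorm := congrArg (Int.cast : ℤ → ZMod q) (im_sq_mul_norm hs hd x)
  push_cast at hnorm
  rw [(ZMod.natCast_eq_zero_iff d q).2 hqd, zero_mul, sub_zero] at hnorm
  refine ⟨(s.im * x.re - s.re * x.im) / s.im, ?_⟩
  field_simp
  linear_combination hnorm

theorem isSquare_natCast_div_of_natAbs_norm_eq {p : ℕ} [Fact p.Prime] (hp : p % 4 = 1)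
    (hpd : p ∣ d) (hx : x.norm.natAbs = p) : IsSquare ((d / p : ℕ) : ZMod p) := by
  have hpp : p.Prime := Fact.out
  have hpi := Nat.prime_iff_prime_int.1 hpp
  have hs_im := not_dvd_im_of_sq_eq hs hd hdsq hpp (by rintro rfl; lia)
  obtain ⟨e, hde⟩ := hpd
  obtain ⟨ε, hε⟩ : (p : ℤ) ∣ x.norm := Int.natCast_dvd.2 hx.symm.dvd
  have hε1 : ε.natAbs = 1 := by
    rwa [hε, Int.natAbs_mul, Int.natAbs_natCast, Nat.mul_eq_left hpp.ne_zero] at hx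
  obtain ⟨c, hmod⟩ := exists_im_sq_mul_eq_of_norm_eq hs hd hpp hde hε
  replace hmod := congrArg (Int.cast : ℤ → ZMod p) hmod
  push_cast at hmod
  rw [ZMod.natCast_self, zero_mul, zero_sub] at hmod
  have hx_im : (x.im : ZMod p) ≠ 0 := by
    intro h
    rw [h, zero_pow two_ne_zero, mul_zero, neg_zero, ← Int.cast_pow, ← Int.cast_mul,
      ZMod.intCast_zmod_eq_zero_iff_dvd] at hmod
    rcases hpi.dvd_or_dvd hmod with h | h
    · exact hs_im (hpi.dvd_of_dvd_pow h)
    · exact hpp.not_isUnit (Nat.isUnit_iff.2 (Nat.eq_one_of_dvd_one (hε1 ▸ Int.natCast_dvd.1 h)))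
  have hεsq : IsSquare (-ε : ZMod p) := by
    rw [isSquare_neg_iff hp, ← isSquare_natAbs_iff hp, hε1]
    simp
  rw [hde, Nat.mul_div_cancel_left _ hpp.pos]
  have he : (e : ZMod p) = -ε * (s.im / x.im) ^ 2 := by
    field_simp
    linear_combination hmod
  exact he ▸ hεsq.mul (IsSquare.sq _)

end SquareRoot

section UnitMultiples

variable {f : ℕ} (hf : Squarefree f)
  (hunits : ∀ x : QuadraticAlgebra ℤ n t, IsCoprime x (f : QuadraticAlgebra ℤ n t) →
    ∃ u : (QuadraticAlgebra ℤ n t)ˣ, u * x ∈ conductorOrder _ f)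

include hf hunits

-- Every norm prime to `q` is congruent modulo `q` to the norm of an element prime to `f`, hence,
-- up to the norm of a unit, to the norm of an integer.
theorem isSquare_norm_of_forall_exists_unit {q : ℕ} [Fact q.Prime] (hq : q % 4 = 1) (hqf : q ∣ f)
    (x : QuadraticAlgebra ℤ n t) : IsSquare (x.norm : ZMod q) := by
  have hqp : q.Prime := Fact.out
  by_cases hqx : (q : ℤ) ∣ x.norm
  · rw [(ZMod.intCast_zmod_eq_zero_iff_dvd _ _).2 hqx]
    exact IsSquare.zero
  have hxq : IsCoprime x (q : QuadraticAlgebra ℤ n t) := isCoprime_natCast_of_isCoprime_norm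
    ((Nat.prime_iff_prime_int.1 hqp).coprime_iff_not_dvd.2 hqx).symm
  obtain ⟨z, hzf, hz⟩ := exists_isCoprime_forall_prime_dvd_sub hf
    (fun p => if p = q then x else 1) fun p _ _ => by
      split_ifs with h
      · exact h ▸ hxq
      · exact isCoprime_one_left
  obtain ⟨u, hu⟩ := hunits z hzf
  obtain ⟨a, ha⟩ := mem_conductorOrder_iff.1 (conductorOrder_le_of_dvd hqf hu)
  have hzx := dvd_norm_sub_norm (hz q hqp hqf)
  have huz := dvd_norm_sub_norm ha
  rw [if_pos rfl, ← ZMod.intCast_eq_intCast_iff_dvd_sub] at hzx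
  rw [← ZMod.intCast_eq_intCast_iff_dvd_sub, QuadraticAlgebra.norm_intCast] at huz
  rw [hzx, ← isSquare_natAbs_iff hq, ← one_mul z.norm.natAbs, ← natAbs_norm_unit u,
    ← Int.natAbs_mul, ← map_mul, isSquare_natAbs_iff hq, ← huz, Int.cast_pow]
  exact IsSquare.sq _

theorem not_associated_sq {d : ℕ} {s : QuadraticAlgebra ℤ n t} (hs : s ^ 2 = d)
    (hd : ¬ IsSquare d) (hdsq : Squarefree d) {p : ℕ} (hp : p.Prime)
    (h : (p % 4 = 1 ∧ jacobiSym ((d / p : ℕ) : ℤ) p = -1) ∨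
      (∃ q : ℕ, q.Prime ∧ q % 4 = 1 ∧ q ∣ d * f ∧ jacobiSym (p : ℤ) q = -1)) :
    ¬ Associated (p : QuadraticAlgebra ℤ n t) (x ^ 2) := by
  intro hx
  have hnorm := natAbs_norm_of_associated_sq hx
  rcases h with ⟨hp4, hj⟩ | ⟨q, hq, hq4, hqdf, hj⟩
  · have := Fact.mk hp
    rw [← jacobiSym.legendreSym.to_jacobiSym, legendreSym.eq_neg_one_iff] at hj
    have hpd := dvd_of_associated_sq hs hd hp (by rintro rfl; lia) hx
    exact hj (by exact_mod_cast isSquare_natCast_div_of_natAbs_norm_eq hs hd hdsq hp4 hpd hnorm)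
  · have := Fact.mk hq
    rw [← jacobiSym.legendreSym.to_jacobiSym, legendreSym.eq_neg_one_iff] at hj
    have hsq : IsSquare (x.norm : ZMod q) := (hq.dvd_mul.1 hqdf).elim
      (fun hqd => isSquare_norm_of_dvd hs hd hdsq (by rintro rfl; lia) hqd x)
      (fun hqf => isSquare_norm_of_forall_exists_unit hf hunits hq4 hqf x)
    rw [← isSquare_natAbs_iff hq4, hnorm] at hsq
    exact hj (by exact_mod_cast hsq)

end UnitMultiples

end NormObstruction

section IdealFactorization

open UniqueFactorizationMonoid

variable {R : Type*} [CommRing R]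

theorem isUnit_coe_nonZeroDivisors_iff {a : R⁰} : IsUnit (a : R) ↔ IsUnit a :=
  ⟨fun ⟨u, hu⟩ => ⟨unitsNonZeroDivisorsEquiv.symm u, Subtype.ext hu⟩, fun h => h.map R⁰.subtype⟩

/-- The ideal `P` is not principal. When the class group has order two, such ideals form one class,
and this is the predicate marking the primes in `balancedMultisets`. -/
def IsNonprincipal (P : Ideal R) : Prop := ¬ P.IsPrincipal

/-- The prime ideal `P` of `R` is ramified over a prime divisor of `f`. -/
def IsRamifiedPrimeOver (f : ℕ) (P : Ideal R) : Prop :=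
  P.IsPrime ∧ ∃ p : ℕ, p.Prime ∧ p ∣ f ∧ Ideal.span {(p : R)} = P ^ 2

variable {f : ℕ} {P : Ideal R}

theorem IsRamifiedPrimeOver.sup_ne_top (hP : IsRamifiedPrimeOver f P) :
    P ⊔ Ideal.span {(f : R)} ≠ ⊤ := by
  obtain ⟨hP, p, -, hpf, hpP⟩ := hP
  have hfP : Ideal.span {(f : R)} ≤ P := calc
    Ideal.span {(f : R)} ≤ Ideal.span {(p : R)} :=
      Ideal.span_singleton_le_span_singleton.2 (Nat.cast_dvd_cast hpf)
    _ = P ^ 2 := hpP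
    _ ≤ P := Ideal.pow_le_self two_ne_zero
  rw [sup_eq_left.2 hfP]
  exact hP.ne_top

variable [IsDedekindDomain R]

theorem isPrincipal_mul_iff (h : Nat.card (CommRing.Pic R) = 2) {I J : Ideal R} (hI : I ≠ 0)
    (hJ : J ≠ 0) : (I * J).IsPrincipal ↔ (I.IsPrincipal ↔ J.IsPrincipal) := by
  rw [← card_classGroup_eq_card_pic] at h
  have hI' := mem_nonZeroDivisors_of_ne_zero hI
  have hJ' := mem_nonZeroDivisors_of_ne_zero hJ
  have hmul : ClassGroup.mk0 ⟨I * J, mul_mem hI' hJ'⟩ =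
      ClassGroup.mk0 ⟨I, hI'⟩ * ClassGroup.mk0 ⟨J, hJ'⟩ := by
    rw [← map_mul]
    rfl
  rw [← ClassGroup.mk0_eq_one_iff hI', ← ClassGroup.mk0_eq_one_iff hJ',
    ← ClassGroup.mk0_eq_one_iff (mul_mem hI' hJ'), hmul, mul_eq_one_iff_eq_inv]
  by_cases hJ1 : ClassGroup.mk0 ⟨J, hJ'⟩ = 1
  · simp [hJ1]
  · have huniq := (Nat.card_eq_two_iff' (1 : ClassGroup R)).1 h
    refine ⟨fun hIJ => ?_, fun hIJ => huniq.unique (mt hIJ.1 hJ1) (inv_ne_one.2 hJ1)⟩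
    rw [hIJ, inv_eq_one]

open Classical in
theorem isPrincipal_prod_iff_even_countP (h : Nat.card (CommRing.Pic R) = 2)
    {M : Multiset (Ideal R)} (hM : ∀ P ∈ M, Prime P) :
    M.prod.IsPrincipal ↔ Even (M.countP IsNonprincipal) := by
  induction M using Multiset.induction_on with
  | empty => simpa using ⟨(1 : R), by simp⟩
  | cons P M ih =>
    obtain ⟨hP, hM⟩ := Multiset.forall_mem_cons.1 hM
    have hprod : M.prod ≠ 0 := Multiset.prod_ne_zero fun h0 => (hM 0 h0).ne_zero rfl
    rw [Multiset.prod_cons, isPrincipal_mul_iff h hP.ne_zero hprod, ih hM, Multiset.countP_cons]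
    by_cases hP : P.IsPrincipal <;> simp [IsNonprincipal, hP, Nat.even_add_one]

theorem exists_prime_not_isPrincipal_sup_eq_top [Nontrivial (ClassGroup R)] {F : Ideal R}
    (hF0 : F ≠ 0) (hF1 : F ≠ ⊤) : ∃ Q : Ideal R, Prime Q ∧ IsNonprincipal Q ∧ Q ⊔ F = ⊤ := by
  obtain ⟨c, hc⟩ := exists_ne (1 : ClassGroup R)
  obtain ⟨⟨A, hA⟩, rfl, hAF⟩ := exists_mk0_eq_and_sup_eq_top hF0 hF1 c
  by_contra! hQ
  refine hc ((ClassGroup.mk0_eq_one_iff hA).2 ?_)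
  rw [← Ideal.prod_normalizedFactors_eq_self (nonZeroDivisors.ne_zero hA)]
  refine Submonoid.multiset_prod_mem (Ideal.isPrincipalSubmonoid R) _ fun Q hQA => ?_
  by_contra hQp
  refine hQ Q (prime_of_normalized_factor Q hQA) hQp (top_le_iff.1 ?_)
  exact hAF.ge.trans (sup_le_sup_right (Ideal.le_of_dvd (dvd_of_mem_normalizedFactors hQA)) F)

theorem normalizedFactors_span_mul {x y : R} (hx : x ≠ 0) (hy : y ≠ 0) :
    normalizedFactors (Ideal.span {x * y}) =
      normalizedFactors (Ideal.span {x}) + normalizedFactors (Ideal.span {y}) := by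
  rw [← Ideal.span_singleton_mul_span_singleton,
    normalizedFactors_mul (by simpa using hx) (by simpa using hy)]

theorem isCoprime_iff_notMem_of_span_eq_pow {P : Ideal R} (hP : Prime P) {p x : R} {k : ℕ}
    (hk : 0 < k) (hpP : Ideal.span {p} = P ^ k) : IsCoprime x p ↔ x ∉ P := by
  have hmax := (Ideal.isPrime_of_prime hP).isMaximal hP.ne_zero
  rw [← Ideal.isCoprime_span_singleton_iff, hpP, IsCoprime.pow_right_iff hk,
    Ideal.isCoprime_iff_sup_eq, sup_comm, ← Ideal.span_singleton_le_iff_mem]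
  exact ⟨fun h hx => hmax.ne_top (by rwa [sup_eq_left.2 hx] at h),
    fun hx => hmax.out.2 _ (left_lt_sup.2 hx)⟩

theorem mem_pow_iff_le_count {P : Ideal R} (hP : Prime P) {x : R} (hx : x ≠ 0) (k : ℕ) :
    x ∈ P ^ k ↔ k ≤ (normalizedFactors (Ideal.span {x})).count P := by
  rw [← Ideal.dvd_span_singleton, dvd_iff_normalizedFactors_le_normalizedFactors
    (pow_ne_zero k hP.ne_zero) (by simpa using hx), hP.irreducible.normalizedFactors_pow,
    normalize_eq, Multiset.le_count_iff_replicate_le]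

theorem isCoprime_or_dvd_iff_count_ne_one {P : Ideal R} (hP : Prime P) {p x : R} (hx : x ≠ 0)
    (hpP : Ideal.span {p} = P ^ 2) :
    (IsCoprime x p ∨ p ∣ x) ↔ (normalizedFactors (Ideal.span {x})).count P ≠ 1 := by
  rw [isCoprime_iff_notMem_of_span_eq_pow hP two_pos hpP, ← Ideal.mem_span_singleton, hpP,
    mem_pow_iff_le_count hP hx]
  nth_rw 1 [← pow_one P]
  rw [mem_pow_iff_le_count hP hx]
  lia

variable [CharZero R]

theorem IsRamifiedPrimeOver.prime (hP : IsRamifiedPrimeOver f P) : Prime P := by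
  obtain ⟨hP, p, hp, -, hpP⟩ := hP
  refine Ideal.prime_of_isPrime ?_ hP
  rintro rfl
  rw [Ideal.bot_pow two_ne_zero, Ideal.span_singleton_eq_bot] at hpP
  exact hp.ne_zero (Nat.cast_eq_zero.1 hpP)

section TransferHomomorphism

variable (hPic : Nat.card (CommRing.Pic R) = 2)
  (hpf : ∀ p : ℕ, p.Prime → p ∣ f → (Ideal.span {(p : R)}).IsPrime ∨
    ∃ P : Ideal R, P.IsPrime ∧ Ideal.span {(p : R)} = P ^ 2)

include hpf

theorem admissibleAt_iff_normalizedFactors_mem_withoutSimple {x : R} (hx : x ≠ 0) :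
    AdmissibleAt f x ↔
      normalizedFactors (Ideal.span {x}) ∈ withoutSimple (IsRamifiedPrimeOver (R := R) f) := by
  constructor
  · intro h P hP
    obtain ⟨-, p, hp, hpf, hpP⟩ := id hP
    exact (isCoprime_or_dvd_iff_count_ne_one hP.prime hx hpP).1 (h p hp hpf)
  · intro h p hp hpf'
    rcases hpf p hp hpf' with hpR | ⟨P, hP, hpP⟩
    · have hpR : Prime (Ideal.span {(p : R)}) := Ideal.prime_of_isPrime (by simp [hp.ne_zero]) hpR
      rw [isCoprime_iff_notMem_of_span_eq_pow hpR one_pos (pow_one _).symm,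
        Ideal.mem_span_singleton]
      exact em' _
    · have hPf : IsRamifiedPrimeOver f P := ⟨hP, p, hp, hpf', hpP⟩
      exact (isCoprime_or_dvd_iff_count_ne_one hPf.prime hx hpP).2 (h P hPf)

include hPic

theorem normalizedFactors_mem_balancedMultisets_iff {x : R} (hx : x ≠ 0) :
    normalizedFactors (Ideal.span {x}) ∈
      balancedMultisets (IsNonprincipal (R := R)) (IsRamifiedPrimeOver f) ↔
    AdmissibleAt f x := by
  rw [admissibleAt_iff_normalizedFactors_mem_withoutSimple hpf hx]
  refine and_iff_left ((isPrincipal_prod_iff_even_countP hPic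
    fun P hP => prime_of_normalized_factor P hP).1 ?_)
  rw [Ideal.prod_normalizedFactors_eq_self (by simpa using hx)]
  exact ⟨x, rfl⟩

theorem exists_normalizedFactors_eq {M : Multiset (Ideal R)} (hM : ∀ P ∈ M, Prime P)
    (hMb : M ∈ balancedMultisets (IsNonprincipal (R := R)) (IsRamifiedPrimeOver f)) :
    ∃ x : R, x ≠ 0 ∧ normalizedFactors (Ideal.span {x}) = M ∧ AdmissibleAt f x := by
  obtain ⟨x, hx⟩ := (isPrincipal_prod_iff_even_countP hPic hM).2 hMb.2
  rw [Ideal.submodule_span_eq] at hx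
  have hfac : normalizedFactors (Ideal.span {x}) = M := hx ▸ normalizedFactors_prod_of_prime hM
  have hx0 : x ≠ 0 := by
    rintro rfl
    refine Multiset.prod_ne_zero (fun h0 => (hM 0 h0).ne_zero rfl) (hx.trans ?_)
    simp
  refine ⟨x, hx0, hfac, ?_⟩
  rwa [← normalizedFactors_mem_balancedMultisets_iff hPic hpf hx0, hfac]

theorem exists_mul_eq_of_normalizedFactors_eq_add (hf : Squarefree f)
    (hunits : ∀ x : R, IsCoprime x (f : R) → ∃ u : Rˣ, u * x ∈ conductorOrder R f)
    {a : R} (ha : a ∈ conductorOrder R f) (ha0 : a ≠ 0) {A B : Multiset (Ideal R)}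
    (hA : A ∈ balancedMultisets (IsNonprincipal (R := R)) (IsRamifiedPrimeOver f))
    (hB : B ∈ balancedMultisets (IsNonprincipal (R := R)) (IsRamifiedPrimeOver f))
    (hAB : normalizedFactors (Ideal.span {a}) = A + B) :
    ∃ x ∈ conductorOrder R f, ∃ y ∈ conductorOrder R f, a = x * y ∧
      normalizedFactors (Ideal.span {x}) = A ∧ normalizedFactors (Ideal.span {y}) = B := by
  have hprime : ∀ P ∈ A + B, Prime P := fun P hP => prime_of_normalized_factor P (hAB ▸ hP)
  obtain ⟨x, hx0, rfl, hx⟩ := exists_normalizedFactors_eq hPic hpf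
    (fun P hP => hprime P (Multiset.mem_add.2 (Or.inl hP))) hA
  obtain ⟨z, hz0, rfl, -⟩ := exists_normalizedFactors_eq hPic hpf
    (fun P hP => hprime P (Multiset.mem_add.2 (Or.inr hP))) hB
  obtain ⟨v, rfl⟩ : Associated (x * z) a := by
    rw [← Ideal.span_singleton_eq_span_singleton,
      ← Ideal.prod_normalizedFactors_eq_self (I := Ideal.span {a}) (by simpa using ha0), hAB,
      ← normalizedFactors_span_mul hx0 hz0,
      Ideal.prod_normalizedFactors_eq_self (by simp [hx0, hz0])]
  rw [mul_assoc] at ha ⊢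
  have hzv : Ideal.span {z * (v : R)} = Ideal.span {z} :=
    Ideal.span_singleton_mul_right_unit v.isUnit z
  have hy : AdmissibleAt f (z * v) := by
    rwa [← normalizedFactors_mem_balancedMultisets_iff hPic hpf (mul_ne_zero hz0 v.ne_zero), hzv]
  obtain ⟨u, hux, huy⟩ := exists_unit_mul_mem_and_inv_mul_mem hf hunits hx hy ha
  refine ⟨u * x, hux, ↑u⁻¹ * (z * v), huy, ?_, ?_, ?_⟩
  · rw [mul_mul_mul_comm, Units.mul_inv, one_mul]
  · rw [Ideal.span_singleton_mul_left_unit u.isUnit]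
  · rw [Ideal.span_singleton_mul_left_unit (Units.isUnit _), hzv]

theorem exists_isTransferHom (hf : Squarefree f)
    (hunits : ∀ x : R, IsCoprime x (f : R) → ∃ u : Rˣ, u * x ∈ conductorOrder R f) :
    ∃ θ : (conductorOrder R f)⁰ →
        balancedMultisets (IsNonprincipal (R := R)) (IsRamifiedPrimeOver f),
      IsTransferHom θ ∧ ∀ a, (θ a : Multiset (Ideal R)) =
        normalizedFactors (Ideal.span {((a : conductorOrder R f) : R)}) := by
  have hne (a : (conductorOrder R f)⁰) : ((a : conductorOrder R f) : R) ≠ 0 :=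
    fun h => nonZeroDivisors.coe_ne_zero a (Subtype.ext h)
  refine ⟨fun a => ⟨_, (normalizedFactors_mem_balancedMultisets_iff hPic hpf (hne a)).2
    (admissibleAt_of_mem_conductorOrder a.1.2)⟩, ⟨fun a b => Subtype.ext ?_, fun a => ?_, ?_⟩,
    fun a => rfl⟩
  · exact normalizedFactors_span_mul (hne a) (hne b)
  · rw [← Subtype.coe_inj, ZeroMemClass.coe_zero, normalizedFactors_eq_zero_iff (by simp),
      Ideal.isUnit_iff, Ideal.span_singleton_eq_top, ← isUnit_conductorOrder_iff hf]
    exact isUnit_coe_nonZeroDivisors_iff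
  · rintro ⟨⟨a, ha⟩, ha'⟩ ⟨A, hA⟩ ⟨B, hB⟩ hAB
    have ha0 : a ≠ 0 := hne ⟨⟨a, ha⟩, ha'⟩
    obtain ⟨x, hx, y, hy, rfl, rfl, rfl⟩ := exists_mul_eq_of_normalizedFactors_eq_add hPic hpf hf
      hunits ha ha0 hA hB (congrArg Subtype.val hAB)
    have hx0 : (⟨x, hx⟩ : conductorOrder R f) ∈ (conductorOrder R f)⁰ :=
      mem_nonZeroDivisors_of_ne_zero fun h => left_ne_zero_of_mul ha0 (congrArg Subtype.val h)
    have hy0 : (⟨y, hy⟩ : conductorOrder R f) ∈ (conductorOrder R f)⁰ :=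
      mem_nonZeroDivisors_of_ne_zero fun h => right_ne_zero_of_mul ha0 (congrArg Subtype.val h)
    exact ⟨⟨_, hx0⟩, ⟨_, hy0⟩, rfl, rfl, rfl⟩

theorem isLeast_ringDistances_conductorOrder (hf : Squarefree f)
    (hunits : ∀ x : R, IsCoprime x (f : R) → ∃ u : Rˣ, u * x ∈ conductorOrder R f)
    (hram : ∀ P : Ideal R, IsRamifiedPrimeOver f P → IsNonprincipal P)
    (hP : IsRamifiedPrimeOver f P) : IsLeast (ringDistances (conductorOrder R f)) 2 := by
  have : Nontrivial (ClassGroup R) := by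
    rw [← card_classGroup_eq_card_pic] at hPic
    have := Nat.finite_of_card_ne_zero (hPic.trans_ne two_ne_zero)
    exact Finite.one_lt_card_iff_nontrivial.1 (hPic ▸ one_lt_two)
  obtain ⟨Q, hQ, hQp, hQf⟩ := exists_prime_not_isPrincipal_sup_eq_top
    (F := Ideal.span {(f : R)}) (by simpa using hf.ne_zero)
    fun h => hP.sup_ne_top (h ▸ sup_top_eq P)
  have hQS : ¬ IsRamifiedPrimeOver f Q := fun hQ => hQ.sup_ne_top hQf
  obtain ⟨x, hx0, hxPQ, hx⟩ := exists_normalizedFactors_eq hPic hpf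
    (M := Multiset.replicate 3 P + {Q}) (by simp [hP.prime, hQ, or_imp, forall_and])
    (replicate_three_add_mem_balancedMultisets (hram P hP) hQp hQS)
  obtain ⟨u, hu⟩ := exists_unit_mul_mem_of_admissibleAt hf hunits hx
  have hu0 : (⟨u * x, hu⟩ : conductorOrder R f) ∈ (conductorOrder R f)⁰ :=
    mem_nonZeroDivisors_of_ne_zero fun h => mul_ne_zero u.ne_zero hx0 (congrArg Subtype.val h)
  obtain ⟨θ, hθ, hθ_eq⟩ := exists_isTransferHom hPic hpf hf hunits
  refine isLeast_monoidDistances_of_isTransferHom hθ hram hP hQp hQS (a := ⟨_, hu0⟩) ?_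
  rw [hθ_eq, Ideal.span_singleton_mul_left_unit u.isUnit, hxPQ]

end TransferHomomorphism

end IdealFactorization

section QuadraticField

variable {K : Type*} [Field K] {f : ℕ}

theorem exists_sq_eq_natCast {d : ℕ} {s : K} (hs : s ^ 2 = (d : K)) :
    ∃ s' : 𝓞 K, s' ^ 2 = (d : 𝓞 K) := by
  have hint : IsIntegral ℤ s := by
    refine IsIntegral.of_pow two_pos ?_
    rw [hs]
    exact_mod_cast isIntegral_algebraMap (R := ℤ) (A := K) (x := (d : ℤ))
  obtain ⟨s', rfl⟩ : ∃ s' : 𝓞 K, (s' : K) = s := ⟨⟨s, hint⟩, rfl⟩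
  exact ⟨s', NumberField.RingOfIntegers.ext (by exact_mod_cast hs)⟩

theorem map_mem_conductorOrder {R S : Type*} [CommRing R] [CommRing S] (φ : R →+* S) {x : R}
    (hx : x ∈ conductorOrder R f) : φ x ∈ conductorOrder S f := by
  obtain ⟨a, ha⟩ := mem_conductorOrder_iff.1 hx
  exact mem_conductorOrder_iff.2 ⟨a, by simpa using map_dvd φ ha⟩

theorem not_isPrincipal_of_span_eq_sq (hf : Squarefree f) {n t : ℤ}
    (φ : 𝓞 K ≃+* QuadraticAlgebra ℤ n t)
    (hunits : ∀ x : 𝓞 K, IsCoprime x (f : 𝓞 K) → ∃ u : (𝓞 K)ˣ, u * x ∈ conductorOrder (𝓞 K) f)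
    {d : ℕ} (hd : ¬ IsSquare d) (hdsq : Squarefree d) {s : 𝓞 K} (hs : s ^ 2 = d)
    {p : ℕ} (hp : p.Prime) {P : Ideal (𝓞 K)} (hP : Ideal.span {(p : 𝓞 K)} = P ^ 2)
    (h : (p % 4 = 1 ∧ jacobiSym ((d / p : ℕ) : ℤ) p = -1) ∨
      (∃ q : ℕ, q.Prime ∧ q % 4 = 1 ∧ q ∣ d * f ∧ jacobiSym (p : ℤ) q = -1)) :
    ¬ P.IsPrincipal := by
  rintro ⟨x, rfl⟩
  rw [Ideal.submodule_span_eq, Ideal.span_singleton_pow, Ideal.span_singleton_eq_span_singleton]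
    at hP
  have hunits' (y : QuadraticAlgebra ℤ n t) (hy : IsCoprime y (f : QuadraticAlgebra ℤ n t)) :
      ∃ u : (QuadraticAlgebra ℤ n t)ˣ, u * y ∈ conductorOrder (QuadraticAlgebra ℤ n t) f := by
    obtain ⟨u, hu⟩ := hunits (φ.symm y) (by simpa using hy.map φ.symm.toRingHom)
    exact ⟨Units.map φ u, by simpa using map_mem_conductorOrder φ.toRingHom hu⟩
  refine not_associated_sq hf hunits' (s := φ s) ?_ hd hdsq hp h (x := φ x) ?_
  · rw [← map_pow, hs, map_natCast]
  · simpa using hP.map φ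

theorem IsRamifiedTimesInert.exists_isRamified (hf : IsRamifiedTimesInert K f) :
    ∃ p, p ∣ f ∧ IsRamified K p := by
  obtain ⟨S, T, ⟨p, hp⟩, hS, -, rfl⟩ := hf
  exact ⟨p, (Finset.dvd_prod_of_mem _ hp).mul_right _, hS p hp⟩

theorem IsRamifiedTimesInert.isRamified_or_isInert (hf : IsRamifiedTimesInert K f) {p : ℕ}
    (hp : p.Prime) (hpf : p ∣ f) : IsRamified K p ∨ IsInert K p := by
  obtain ⟨S, T, -, hS, hT, rfl⟩ := hf
  have hmem {U : Finset ℕ} (hU : ∀ q ∈ U, q.Prime) (hpU : p ∣ ∏ q ∈ U, q) : p ∈ U := by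
    obtain ⟨q, hq, hpq⟩ := (hp.prime.dvd_finsetProd_iff _).1 hpU
    rwa [(Nat.prime_dvd_prime_iff_eq hp (hU q hq)).1 hpq]
  exact (hp.dvd_mul.1 hpf).imp (fun h => hS p (hmem (fun q hq => (hS q hq).1) h))
    fun h => hT p (hmem (fun q hq => (hT q hq).1) h)

variable [NumberField K]

theorem IsRamified.not_isInert {p : ℕ} (h : IsRamified K p) : ¬ IsInert K p := by
  rintro ⟨hp, hpP⟩
  obtain ⟨-, P, -, hP⟩ := h
  have hprime := Ideal.prime_of_isPrime (by simpa using hp.ne_zero) hpP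
  exact not_irreducible_pow (by decide) (hP ▸ hprime.irreducible)

theorem IsRamifiedTimesInert.squarefree (hf : IsRamifiedTimesInert K f) : Squarefree f := by
  obtain ⟨S, T, -, hS, hT, rfl⟩ := hf
  have hdisj : Disjoint S T :=
    Finset.disjoint_left.2 fun p hpS hpT => (hS p hpS).not_isInert (hT p hpT)
  have hprime : ∀ p ∈ S.disjUnion T hdisj, p.Prime := fun p hp =>
    (Finset.mem_disjUnion.1 hp).elim (fun h => (hS p h).1) fun h => (hT p h).1
  rw [← Finset.prod_disjUnion hdisj]
  exact Finset.squarefree_prod_of_pairwise_isCoprime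
    (fun p hp q hq hpq => Nat.coprime_iff_isRelPrime.1 <|
      (Nat.coprime_primes (hprime p hp) (hprime q hq)).2 hpq)
    fun p hp => (hprime p hp).prime.squarefree

theorem exists_unit_mul_mem_conductorOrder (hf : f ≠ 0)
    (hPic : Nat.card (CommRing.Pic (conductorOrder (𝓞 K) f)) = Nat.card (CommRing.Pic (𝓞 K)))
    {x : 𝓞 K} (hx : IsCoprime x (f : 𝓞 K)) :
    ∃ u : (𝓞 K)ˣ, u * x ∈ conductorOrder (𝓞 K) f := by
  have : Finite (CommRing.Pic (conductorOrder (𝓞 K) f)) := by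
    apply Nat.finite_of_card_ne_zero
    rw [hPic, ← card_classGroup_eq_card_pic]
    exact Nat.card_pos.ne'
  refine exists_unit_mul_mem_of_card_pic_le (F := Ideal.span {(f : 𝓞 K)})
    (fun y hy => mem_conductorOrder_of_dvd (Ideal.mem_span_singleton.1 hy)) (by simpa using hf)
    hPic.le ?_
  rwa [← Ideal.isCoprime_iff_sup_eq, Ideal.isCoprime_span_singleton_iff]

end QuadraticField

end QuadOrder

theorem proposition4p19 (d : ℕ) (hd : 2 ≤ d) (hdsq : Squarefree d)
    -- the field `K = ℚ(√d)`
    (K : Type*) [Field K] [NumberField K]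
    (hK : ∃ s : K, s ^ 2 = (d : K) ∧ IntermediateField.adjoin ℚ {s} = ⊤)
    (f : ℕ) (hf : QuadOrder.IsRamifiedTimesInert K f)
    -- the order in `K` with conductor `f 𝓞_K`
    (O : Subring (𝓞 K)) (hO : QuadOrder.IsOrder O)
    (hcond : QuadOrder.orderConductor O = Ideal.span {(f : 𝓞 K)})
    (hPicO : Nat.card (CommRing.Pic O) = 2)
    (hPicK : Nat.card (CommRing.Pic (𝓞 K)) = 2)
    -- at the odd primes `p` and `q` that occur here the quadratic symbol is `jacobiSym`
    (hram : ∀ p : ℕ, QuadOrder.IsRamified K p → p ∣ f →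
      (p % 4 = 1 ∧ jacobiSym ((d / p : ℕ) : ℤ) p = -1) ∨
      (∃ q : ℕ, q.Prime ∧ q % 4 = 1 ∧ q ∣ d * f ∧ jacobiSym (p : ℤ) q = -1)) :
    IsLeast (QuadOrder.ringDistances O) 2 := by
  obtain ⟨s, hs, htop⟩ := hK
  have hd' := QuadOrder.not_isSquare_of_squarefree hd hdsq
  obtain ⟨ω, hω⟩ := QuadOrder.exists_bijective_intCast_add_intCast_mul
    (QuadOrder.finrank_eq_two_of_sq_eq hd' hs htop)
  obtain rfl : O = QuadOrder.conductorOrder (𝓞 K) f :=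
    QuadOrder.eq_conductorOrder_of_orderConductor_eq
      (fun x => (hω.2 x).elim fun c hc => ⟨c.1, c.2, hc.symm⟩) hcond
  obtain ⟨n, t, ⟨φ⟩⟩ := QuadOrder.exists_ringEquiv_quadraticAlgebra hω
  obtain ⟨s', hs'⟩ := QuadOrder.exists_sq_eq_natCast hs
  have hunits (x : 𝓞 K) (hx : IsCoprime x (f : 𝓞 K)) :=
    QuadOrder.exists_unit_mul_mem_conductorOrder hf.squarefree.ne_zero (hPicO.trans hPicK.symm) hx
  obtain ⟨p, hpf, hp, P, hP, hpP⟩ := hf.exists_isRamified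
  refine QuadOrder.isLeast_ringDistances_conductorOrder hPicK (fun q hq hqf => ?_) hf.squarefree
    hunits ?_ ⟨hP, p, hp, hpf, hpP⟩
  · exact (hf.isRamified_or_isInert hq hqf).symm.imp And.right And.right
  · rintro Q ⟨hQ, q, hq, hqf, hqQ⟩
    exact QuadOrder.not_isPrincipal_of_span_eq_sq hf.squarefree φ hunits hd' hdsq hs' hq hqQ
      (hram q ⟨hq, Q, hQ, hqQ⟩ hqf)
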